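/- Let $a>0$, $h_0>0$ and $\dot h_0\in\mathbb R$. Let $b\colon\mathbb R\to\mathbb R$ be locally Lipschitz continuous and such that $B(y):=\int_0^y b(w)\,dw\to\infty$ as $|y|\to\infty$. Let $\mathcal D\colon(0,\infty)\times\mathbb R\to(0,\infty)$ be locally Lipschitz continuous and such that, for some constants $c>0$ and $\alpha\ge 1$, $\mathcal D(h,\xi)\ge c\,h^{-\alpha}$ for all $h>0$ and $\xi\in\mathbb R$. Then for every $\mu>0$ the system $$\ddot h-\ddot\xi=a\,b(\xi),\qquad \ddot h=-b(\xi)-\mu\,\mathcal D(h,\xi)\,\dot h,\qquad h(0)=h_0,\ \dot h(0)=\dot h_0,\ \xi(0)=\dot\xi(0)=0,$$ has a unique global solution $(h_\mu,\xi_\mu)$ on $[0,\infty)$ with $h_\mu>0$. Set $H(t):=\max\{0,h_0+\dot h_0t\}$ for $t\ge 0$ and, if $\dot h_0<0$, $t_0:=-h_0/\dot h_0$. The following statements hold. (i) If $b(0)=0$ and $\dot h_0<0$, then, as $\mu\to0^+$, $h_\mu\to H$ and $\xi_\mu\to0$ uniformly on $[0,t_0]$. (ii) If $b(0)=0$ and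 $\dot h_0\ge0$, then, as $\mu\to0^+$, $h_\mu\to H$ and $\xi_\mu\to0$ uniformly on compact subsets of $[0,\infty)$. (iii) Assume that $\dot h_0<0$, that $B\ge0$ on $\mathbb R$, and that there are constants $C_1,C_2>0$ and $\alpha\ge1$ and a locally Lipschitz continuous function $g\colon(0,\infty)\to[C_1,C_2]$ with $\mathcal D(h,\xi)=g(h)h^{-\alpha}$ for all $h>0$ and $\xi\in\mathbb R$. Then the initial value problem $$\ddot\zeta+a\,b(\zeta)=0,\qquad \zeta(t_0)=0,\ \dot\zeta(t_0)=-\dot h_0,$$ has a unique solution $\zeta$ on $[t_0,\infty)$. Let $\xi(t):=0$ for $0\le t\le t_0$ and $\xi(t):=\zeta(t)$ for $t>t_0$. Then, as $\mu\to0^+$, $h_\mu\to H$ and $\xi_\mu\to\xi$ uniformly on compact subsets of $[0,\infty)$. -/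

import Mathlib

open Set Filter Topology

/-- `x` is twice differentiable on the interval `s` (one-sidedly at an end point of `s`), with
velocity `v` and acceleration `A`. -/
def IsMotionOn (s : Set ℝ) (x v A : ℝ → ℝ) : Prop :=
  ∀ t ∈ s, HasDerivWithinAt x (v t) s t ∧ HasDerivWithinAt v (A t) s t

/-- The elastic potential `B(y) = ∫₀^y b(w) dw`. -/
noncomputable def potential (b : ℝ → ℝ) (y : ℝ) : ℝ := ∫ w in (0 : ℝ)..y, b w

/-- Standing assumptions on the elastic response: `b` is locally Lipschitz continuous and its
potential is coercive, that is, `B(y) → ∞` as `|y| → ∞`. -/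
structure ElasticResponse (b : ℝ → ℝ) : Prop where
  locallyLipschitz : LocallyLipschitz b
  coercive : Tendsto (potential b) (cocompact ℝ) atTop

/-- Standing assumptions on the drag factor `D : (0, ∞) × ℝ → (0, ∞)`: it is locally Lipschitz
continuous, and there are `c > 0` and `α ≥ 1` with `D(h, ξ) ≥ c h ^ (-α)`. Only the values of `D`
at `h > 0` matter; they are positive by the lower bound. -/
structure DragFactor (D : ℝ → ℝ → ℝ) : Prop where
  locallyLipschitzOn : LocallyLipschitzOn (Ioi (0 : ℝ) ×ˢ (univ : Set ℝ)) fun p : ℝ × ℝ => D p.1 p.2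
  lower_bound : ∃ c > (0 : ℝ), ∃ α : ℝ, 1 ≤ α ∧ ∀ h > (0 : ℝ), ∀ ξ : ℝ, c * h ^ (-α) ≤ D h ξ

/-- The rigid-shell condition: `D(h, ξ) = g(h) h ^ (-α)` for all `h > 0` and `ξ`, where `α ≥ 1` and
`g : (0, ∞) → [C₁, C₂]` is locally Lipschitz continuous, with `C₁, C₂ > 0`. -/
def RigidDrag (D : ℝ → ℝ → ℝ) : Prop :=
  ∃ C₁ > (0 : ℝ), ∃ C₂ > (0 : ℝ), ∃ α : ℝ, 1 ≤ α ∧ ∃ g : ℝ → ℝ,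
    LocallyLipschitzOn (Ioi (0 : ℝ)) g ∧ (∀ h > (0 : ℝ), g h ∈ Icc C₁ C₂) ∧
      ∀ h > (0 : ℝ), ∀ ξ : ℝ, D h ξ = g h * h ^ (-α)

/-- `(h, ξ)` is a global classical solution on `[0, ∞)`, with `h > 0`, of the system
`h'' - ξ'' = a b(ξ)`, `h'' = -b(ξ) - μ D(h, ξ) h'` with initial positions `h₀`, `ξ₀` and initial
velocities `h₁`, `ξ₁`. -/
def IsGlobalSolution (a μ : ℝ) (b : ℝ → ℝ) (D : ℝ → ℝ → ℝ) (h₀ h₁ ξ₀ ξ₁ : ℝ)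
    (h ξ : ℝ → ℝ) : Prop :=
  (∀ t, 0 ≤ t → 0 < h t) ∧
  ∃ vh Ah vξ Aξ : ℝ → ℝ,
    IsMotionOn (Ici 0) h vh Ah ∧ IsMotionOn (Ici 0) ξ vξ Aξ ∧
    h 0 = h₀ ∧ vh 0 = h₁ ∧ ξ 0 = ξ₀ ∧ vξ 0 = ξ₁ ∧
    ∀ t, 0 ≤ t →
      Ah t - Aξ t = a * b (ξ t) ∧ Ah t = -b (ξ t) - μ * D (h t) (ξ t) * vh t

/-- `ζ` solves the free oscillator equation `ζ'' + a b(ζ) = 0` on `[t₀, ∞)` with `ζ(t₀) = 0` and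
`ζ'(t₀) = v₀`. -/
def IsFreeOscillation (a : ℝ) (b : ℝ → ℝ) (t₀ v₀ : ℝ) (ζ : ℝ → ℝ) : Prop :=
  ∃ v A : ℝ → ℝ, IsMotionOn (Ici t₀) ζ v A ∧ ζ t₀ = 0 ∧ v t₀ = v₀ ∧
    ∀ t, t₀ ≤ t → A t + a * b (ζ t) = 0

/-- Uniform convergence of `f μ` to `F` on the set `K` as `μ → 0⁺`. -/
def VanishingLimitOn (f : ℝ → ℝ → ℝ) (F : ℝ → ℝ) (K : Set ℝ) : Prop :=
  TendstoUniformlyOn f F (𝓝[>] (0 : ℝ)) K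

/-- Uniform convergence of `f μ` to `F` on compact subsets of `[0, ∞)` as `μ → 0⁺`. -/
def VanishingLimitOnCompacts (f : ℝ → ℝ → ℝ) (F : ℝ → ℝ) : Prop :=
  ∀ K : Set ℝ, IsCompact K → K ⊆ Ici 0 → VanishingLimitOn f F K

/-- The hit-and-stick profile `H(t) = max {0, h₀ + h₁ t}`. -/
noncomputable def hitAndStick (h₀ h₁ t : ℝ) : ℝ := max 0 (h₀ + h₁ * t)

/-!
Writing `v = h'` and `w = ξ'`, the system becomes a first-order equation on the part `h > 0` of the
phase space, with a locally Lipschitz vector field. The energy `a v² / 2 + (v - w)² / 2 + a B(ξ)` is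
dissipated by the drag (`IsShellMotion.energy_le`), and `B` is coercive, so `v`, `w` and `ξ` are
bounded uniformly in time and in the viscosity (`ElasticResponse.exists_uniform_bounds`). There is
no contact in finite time, because the drag dominates a multiple of `(log h)'` whenever `h`
decreases (`IsShellMotion.le_log`). On bounded time intervals every solution thus stays in one
compact box, which gives global existence and uniqueness: the vector field composed with the
retraction onto the box is bounded and globally Lipschitz, and its solution never leaves the box
(`HasAPrioriBounds.exists_global`).

Before contact, and when there is no contact, the drag is `O(μ)` as long as `h` stays away from `0`.
If `b(0) = 0`, the free flight `(h₀ + h₁ t, 0)` solves the system without drag, and Grönwall's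
inequality gives the convergence (`eventually_close_to_free_flight`).

For the time after contact, with a drag that depends only on `h`, let `G` be a primitive of the
drag. Then `a v + (v - w) + a μ G(h)` is conserved, and for `B ≥ 0` the energy estimate bounds
`a v² + (v - w)²` by its initial value `(a + 1) h₁²`. Expanding the squares turns these two facts
into `a (v - h₁)² + (v - w - h₁)² ≤ 2 a μ h₁ G(h)` (`IsShellMotion.sq_velocity_sub_le` keeps the
first square). So `v` is close to `h₁ < 0` whenever `h` is not small: the shell flies freely
towards the wall and cannot rebound (`abs_sub_hitAndStick_le`). Once `h → H` is known, the
difference `z = h - ξ`, which solves `z'' = a b(h - z)`, is compared by Grönwall's inequality with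
the solution of `Z'' = a b(H - Z)` (`vanishingLimitOn_oscillation`).
-/

/-! ### Global solutions of autonomous equations from a priori bounds -/

/-- `K` is the image of a Lipschitz retraction of the whole space. -/
def IsLipschitzRetract {E : Type*} [PseudoEMetricSpace E] (K : Set E) : Prop :=
  ∃ (C : NNReal) (r : E → E), LipschitzWith C r ∧ (∀ x, r x ∈ K) ∧ ∀ x ∈ K, r x = x

theorem isLipschitzRetract_Icc {p q : ℝ} (hpq : p ≤ q) : IsLipschitzRetract (Icc p q) := by
  refine ⟨1, fun x => projIcc p q hpq x, ?_, fun x => (projIcc p q hpq x).2, fun x hx => ?_⟩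
  · have := (LipschitzWith.subtype_val (Icc p q)).comp (LipschitzWith.projIcc hpq)
    rwa [mul_one] at this
  · simp [projIcc_of_mem hpq hx]

theorem IsLipschitzRetract.prod {E F : Type*} [PseudoEMetricSpace E] [PseudoEMetricSpace F]
    {K : Set E} {L : Set F} (hK : IsLipschitzRetract K) (hL : IsLipschitzRetract L) :
    IsLipschitzRetract (K ×ˢ L) := by
  obtain ⟨C, r, hr, hrK, hr'⟩ := hK
  obtain ⟨C', s, hs, hsL, hs'⟩ := hL
  refine ⟨_, fun x => (r x.1, s x.2),
    (hr.comp LipschitzWith.prod_fst).prodMk (hs.comp LipschitzWith.prod_snd),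
    fun x => ⟨hrK _, hsL _⟩, fun x hx => ?_⟩
  simp only [hr' _ hx.1, hs' _ hx.2]

theorem HasDerivWithinAt.Ici_of_Icc {E : Type*} [NormedAddCommGroup E] [NormedSpace ℝ E]
    {f : ℝ → E} {f' : E} {p q t : ℝ} (hf : HasDerivWithinAt f f' (Icc p q) t) (ht : t ∈ Ico p q) :
    HasDerivWithinAt f f' (Ici t) t :=
  hf.mono_of_mem_nhdsWithin
    (mem_of_superset (Icc_mem_nhdsGE ht.2) (Icc_subset_Icc_left ht.1))

section GlobalSolution

variable {E : Type*} [NormedAddCommGroup E] [NormedSpace ℝ E]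

/-- A priori bounds for `x' = F x`, `x t₀ = x₀` in `U`: on every bounded time interval, each
solution with values in `U` stays in the interior of one compact Lipschitz retract `K ⊆ U`. -/
def HasAPrioriBounds (F : E → E) (U : Set E) (t₀ : ℝ) (x₀ : E) : Prop :=
  ∀ T, t₀ < T → ∃ K : Set E, IsCompact K ∧ IsLipschitzRetract K ∧ K ⊆ U ∧ x₀ ∈ K ∧
    ∀ τ ∈ Icc t₀ T, ∀ x : ℝ → E, x t₀ = x₀ → IsIntegralCurveOn x (fun _ => F) (Icc t₀ τ) →
      MapsTo x (Icc t₀ τ) U → x τ ∈ interior K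

variable {F : E → E} {U : Set E} {t₀ : ℝ} {x₀ : E}

theorem IsIntegralCurveOn.hasDerivWithinAt_Ici {x : ℝ → E} {v : ℝ → E → E} {T t : ℝ}
    (hx : IsIntegralCurveOn x v (Icc t₀ T)) (ht : t ∈ Ico t₀ T) :
    HasDerivWithinAt x (v t (x t)) (Ici t) t :=
  (hx t (Ico_subset_Icc_self ht)).Ici_of_Icc ht

theorem IsIntegralCurveOn.continuousOn_of_hasDerivWithinAt {x : ℝ → E} {v : ℝ → E → E} {s : Set ℝ}
    (hx : IsIntegralCurveOn x v s) : ContinuousOn x s :=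
  fun t ht => (hx t ht).continuousWithinAt

theorem HasAPrioriBounds.eqOn_Icc (hap : HasAPrioriBounds F U t₀ x₀) (hF : LocallyLipschitzOn U F)
    {T : ℝ} {x y : ℝ → E}
    (hx0 : x t₀ = x₀) (hx : IsIntegralCurveOn x (fun _ => F) (Icc t₀ T)) (hxU : MapsTo x (Icc t₀ T) U)
    (hy0 : y t₀ = x₀) (hy : IsIntegralCurveOn y (fun _ => F) (Icc t₀ T))
    (hyU : MapsTo y (Icc t₀ T) U) : EqOn x y (Icc t₀ T) := by
  rcases lt_or_ge t₀ T with hT | hT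
  · obtain ⟨K, hKc, -, hKU, -, hK⟩ := hap T hT
    obtain ⟨L, hL⟩ := (hF.mono hKU).exists_lipschitzOnWith_of_compact hKc
    have key : ∀ z : ℝ → E, z t₀ = x₀ → IsIntegralCurveOn z (fun _ => F) (Icc t₀ T) →
        MapsTo z (Icc t₀ T) U → ∀ t ∈ Ico t₀ T, z t ∈ K := by
      intro z hz0 hz hzU t ht
      have hsub : Icc t₀ t ⊆ Icc t₀ T := Icc_subset_Icc_right ht.2.le
      exact interior_subset (hK t ⟨ht.1, ht.2.le⟩ z hz0
        (fun s hs => (hz s (hsub hs)).mono hsub) (hzU.mono_left hsub))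
    exact ODE_solution_unique_of_mem_Icc_right (v := fun _ => F) (s := fun _ => K)
      (fun _ _ => hL) hx.continuousOn_of_hasDerivWithinAt (fun t ht => hx.hasDerivWithinAt_Ici ht)
      (key x hx0 hx hxU) hy.continuousOn_of_hasDerivWithinAt
      (fun t ht => hy.hasDerivWithinAt_Ici ht) (key y hy0 hy hyU) (hx0.trans hy0.symm)
  · intro t ht
    have : t = t₀ := le_antisymm (ht.2.trans hT) ht.1
    rw [this, hx0, hy0]

theorem HasAPrioriBounds.exists_Icc [CompleteSpace E] (hap : HasAPrioriBounds F U t₀ x₀)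
    (hF : LocallyLipschitzOn U F) {T : ℝ} (hT : t₀ < T) :
    ∃ x : ℝ → E, x t₀ = x₀ ∧ IsIntegralCurveOn x (fun _ => F) (Icc t₀ T) ∧
      MapsTo x (Icc t₀ T) U := by
  obtain ⟨K, hKc, ⟨C, r, hr, hrK, hr'⟩, hKU, hx₀, hK⟩ := hap T hT
  obtain ⟨L, hL⟩ := (hF.mono hKU).exists_lipschitzOnWith_of_compact hKc
  have hlip : LipschitzWith (L * C) (F ∘ r) := by
    rw [← lipschitzOnWith_univ]
    exact hL.comp hr.lipschitzOnWith (fun x _ => hrK x)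
  obtain ⟨M, hM⟩ := hKc.exists_bound_of_continuousOn hL.continuousOn
  have hM0 : 0 ≤ M := (norm_nonneg _).trans (hM x₀ hx₀)
  have hPL : IsPicardLindelof (fun _ => F ∘ r) (⟨t₀, left_mem_Icc.2 hT.le⟩ : Icc t₀ T) x₀
      (Real.toNNReal M * Real.toNNReal (T - t₀)) 0 (Real.toNNReal M) (L * C) := by
    refine ⟨fun t _ => hlip.lipschitzOnWith, fun x _ => continuousOn_const, fun t _ x _ => ?_, ?_⟩
    · rw [Real.coe_toNNReal _ hM0]
      exact hM _ (hrK x)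
    · have : 0 ≤ T - t₀ := sub_nonneg.2 hT.le
      simp [this]
  obtain ⟨x, hx0, hx⟩ := hPL.exists_eq_forall_mem_Icc_hasDerivWithinAt₀
  simp only at hx0
  have hxc : ContinuousOn x (Icc t₀ T) := fun t ht => (hx t ht).continuousWithinAt
  -- at the first exit time the solution of the truncated equation is still a solution of the
  -- original one, so the a priori bound excludes an exit
  have hint : ∀ t ∈ Icc t₀ T, x t ∈ interior K := by
    by_contra! hne
    obtain ⟨t₁, ht₁, hxt₁⟩ := hne
    set A := Icc t₀ T ∩ x ⁻¹' (interior K)ᶜ with hA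
    have hAc : IsClosed A := hxc.preimage_isClosed_of_isClosed isClosed_Icc
      isOpen_interior.isClosed_compl
    have hAne : A.Nonempty := ⟨t₁, ht₁, hxt₁⟩
    have hAb : BddBelow A := ⟨t₀, fun t ht => ht.1.1⟩
    have hsA : sInf A ∈ A := hAc.csInf_mem hAne hAb
    set s := sInf A with hs
    have hbefore : ∀ t ∈ Ico t₀ s, x t ∈ K := by
      intro t ht
      by_contra hcon
      have : t ∈ A := ⟨⟨ht.1, ht.2.le.trans hsA.1.2⟩, fun h => hcon (interior_subset h)⟩
      exact absurd (csInf_le hAb this) (not_le.2 ht.2)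
    have hsK : ∀ t ∈ Icc t₀ s, x t ∈ K := by
      rcases eq_or_lt_of_le hsA.1.1 with h | h
      · intro t ht
        have : t = t₀ := le_antisymm (ht.2.trans h.ge) ht.1
        rw [this, hx0]; exact hx₀
      · intro t ht
        have hcl : t ∈ closure (Ico t₀ s) := by rwa [closure_Ico h.ne]
        have hmt : MapsTo x (Ico t₀ s) K := hbefore
        have hc : ContinuousOn x (closure (Ico t₀ s)) := by
          rw [closure_Ico h.ne]
          exact hxc.mono (Icc_subset_Icc_right hsA.1.2)
        exact hKc.isClosed.closure_subset (hmt.closure_of_continuousOn hc hcl)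
    refine hsA.2 (hK s hsA.1 x hx0 (fun t ht => ?_) (fun t ht => hKU (hsK t ht)))
    have h1 := (hx t ⟨ht.1, ht.2.trans hsA.1.2⟩).mono (Icc_subset_Icc_right hsA.1.2)
    simpa only [Function.comp_apply, hr' _ (hsK t ht)] using h1
  refine ⟨x, hx0, fun t ht => ?_, fun t ht => hKU (interior_subset (hint t ht))⟩
  simpa only [Function.comp_apply, hr' _ (interior_subset (hint t ht))] using hx t ht

/-- A priori bounds and a locally Lipschitz vector field give a unique global forward solution. -/
theorem HasAPrioriBounds.exists_global [CompleteSpace E] (hap : HasAPrioriBounds F U t₀ x₀)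
    (hF : LocallyLipschitzOn U F) :
    ∃ x : ℝ → E, x t₀ = x₀ ∧ IsIntegralCurveOn x (fun _ => F) (Ici t₀) ∧ MapsTo x (Ici t₀) U ∧
      ∀ y : ℝ → E, y t₀ = x₀ → IsIntegralCurveOn y (fun _ => F) (Ici t₀) →
        MapsTo y (Ici t₀) U → EqOn y x (Ici t₀) := by
  choose! X hX0 hX hXU using fun T (hT : t₀ < T) => hap.exists_Icc hF hT
  have hagree : ∀ S T, t₀ < S → S ≤ T → EqOn (X T) (X S) (Icc t₀ S) := by
    intro S T hS hST
    have hsub : Icc t₀ S ⊆ Icc t₀ T := Icc_subset_Icc_right hST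
    have hT := hS.trans_le hST
    exact hap.eqOn_Icc hF (hX0 T hT) (fun t ht => (hX T hT t (hsub ht)).mono hsub)
      ((hXU T hT).mono_left hsub) (hX0 S hS) (hX S hS) (hXU S hS)
  set x : ℝ → E := fun t => X (t + 1) t with hxdef
  have hx : ∀ T, t₀ < T → EqOn x (X T) (Icc t₀ T) := by
    intro T hT t ht
    rcases le_total T (t + 1) with h | h
    · exact hagree T (t + 1) hT h ht
    · exact (hagree (t + 1) T (by linarith [ht.1]) h ⟨ht.1, by linarith⟩).symm
  refine ⟨x, ?_, fun t ht => ?_, fun t ht => ?_, fun y hy0 hy hyU t ht => ?_⟩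
  · exact hX0 _ (by linarith)
  · have ht' : t₀ ≤ t := ht
    have hT : t₀ < t + 1 := by linarith
    have hmem : t ∈ Icc t₀ (t + 1) := ⟨ht, by linarith⟩
    have h1 : HasDerivWithinAt x (F (X (t + 1) t)) (Icc t₀ (t + 1)) t :=
      (hX (t + 1) hT t hmem).congr (hx _ hT) (hx _ hT hmem)
    refine h1.mono_of_mem_nhdsWithin ?_
    rw [← Ici_inter_Iic]
    exact inter_mem self_mem_nhdsWithin (mem_nhdsWithin_of_mem_nhds (Iic_mem_nhds (by linarith)))
  · have ht' : t₀ ≤ t := ht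
    exact hXU (t + 1) (by linarith) ⟨ht, by linarith⟩
  · have ht' : t₀ ≤ t := ht
    have hT : t₀ < t + 1 := by linarith
    have hsub : Icc t₀ (t + 1) ⊆ Ici t₀ := Icc_subset_Ici_self
    exact hap.eqOn_Icc hF hy0 (fun t ht => (hy t (hsub ht)).mono hsub) (hyU.mono_left hsub)
      (hX0 _ hT) (hX _ hT) (hXU _ hT) ⟨ht, by linarith⟩

end GlobalSolution

/-! ### Local Lipschitz continuity and one-sided derivatives -/

theorem LocallyLipschitz.comp_locallyLipschitzOn {α β γ : Type*} [PseudoEMetricSpace α]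
    [PseudoEMetricSpace β] [PseudoEMetricSpace γ] {f : β → γ} {g : α → β} {s : Set α}
    (hf : LocallyLipschitz f) (hg : LocallyLipschitzOn s g) : LocallyLipschitzOn s (f ∘ g) :=
  locallyLipschitzOn_iff_restrict.2 (hf.comp (locallyLipschitzOn_iff_restrict.1 hg))

theorem LocallyLipschitzOn.comp_mapsTo {α β γ : Type*} [PseudoEMetricSpace α]
    [PseudoEMetricSpace β] [PseudoEMetricSpace γ] {f : β → γ} {g : α → β} {s : Set α} {u : Set β}
    (hf : LocallyLipschitzOn u f) (hg : LocallyLipschitz g) (h : MapsTo g s u) :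
    LocallyLipschitzOn s (f ∘ g) := by
  intro x hx
  obtain ⟨C, t, ht, hgt⟩ := hg x
  obtain ⟨C', t', ht', hft⟩ := hf (h hx)
  have hpre : g ⁻¹' t' ∈ 𝓝[s] x :=
    (hg.continuous.continuousAt.continuousWithinAt.tendsto_nhdsWithin h) ht'
  exact ⟨C' * C, t ∩ g ⁻¹' t', inter_mem (mem_nhdsWithin_of_mem_nhds ht) hpre,
    hft.comp (hgt.mono inter_subset_left) fun y hy => hy.2⟩

theorem LocallyLipschitzOn.prodMk {α β γ : Type*} [PseudoEMetricSpace α]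
    [PseudoEMetricSpace β] [PseudoEMetricSpace γ] {f : α → β} {g : α → γ} {s : Set α}
    (hf : LocallyLipschitzOn s f) (hg : LocallyLipschitzOn s g) :
    LocallyLipschitzOn s fun x => (f x, g x) :=
  locallyLipschitzOn_iff_restrict.2
    ((locallyLipschitzOn_iff_restrict.1 hf).prodMk (locallyLipschitzOn_iff_restrict.1 hg))

/-- The negative part `min v 0` of a right differentiable function is right differentiable, also
at the zeros of `v`. -/
theorem HasDerivWithinAt.min_zero {v : ℝ → ℝ} {v' t : ℝ} (hv : HasDerivWithinAt v v' (Ici t) t) :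
    ∃ d, HasDerivWithinAt (fun s => min (v s) 0) d (Ici t) t ∧ (v t < 0 → d = v') ∧
      (0 < v t → d = 0) ∧ (v t = 0 → d = min v' 0) := by
  rcases lt_trichotomy (v t) 0 with h | h | h
  · refine ⟨v', ?_, fun _ => rfl, fun h' => absurd h' h.not_gt, fun h' => absurd h' h.ne⟩
    refine hv.congr_of_eventuallyEq ?_ (min_eq_left h.le)
    filter_upwards [hv.continuousWithinAt.eventually_lt_const h] with s hs
    exact min_eq_left hs.le
  · refine ⟨min v' 0, ?_, fun h' => absurd h h'.ne, fun h' => absurd h h'.ne', fun _ => rfl⟩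
    rw [hasDerivWithinAt_iff_tendsto_slope, Ici_sdiff_left] at hv ⊢
    refine (hv.min tendsto_const_nhds).congr' ?_
    filter_upwards [self_mem_nhdsWithin] with s hs
    have hst : 0 < s - t := sub_pos.2 hs
    simp only [slope_def_field, h, min_self, sub_zero]
    rw [← min_div_div_right hst.le, zero_div]
  · refine ⟨0, ?_, fun h' => absurd h' h.not_gt, fun _ => rfl, fun h' => absurd h' h.ne'⟩
    refine (hasDerivWithinAt_const t (Ici t) (0 : ℝ)).congr_of_eventuallyEq ?_ (min_eq_right h.le)
    filter_upwards [hv.continuousWithinAt.eventually_const_lt h] with s hs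
    exact min_eq_right hs.le

/-! ### The system as a first-order system -/

/-- The second-order system written with the velocities `v` of `h` and `w` of `ξ`. -/
structure IsShellMotion (a μ : ℝ) (b : ℝ → ℝ) (D : ℝ → ℝ → ℝ) (s : Set ℝ)
    (h v ξ w : ℝ → ℝ) : Prop where
  pos : ∀ t ∈ s, 0 < h t
  deriv_h : ∀ t ∈ s, HasDerivWithinAt h (v t) s t
  deriv_v : ∀ t ∈ s, HasDerivWithinAt v (-b (ξ t) - μ * D (h t) (ξ t) * v t) s t
  deriv_ξ : ∀ t ∈ s, HasDerivWithinAt ξ (w t) s t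
  deriv_w : ∀ t ∈ s,
    HasDerivWithinAt w (-b (ξ t) - μ * D (h t) (ξ t) * v t - a * b (ξ t)) s t

/-- The vector field of the first-order system on the phase space of points `(h, v, ξ, w)`. -/
def shellField (a μ : ℝ) (b : ℝ → ℝ) (D : ℝ → ℝ → ℝ) (p : ℝ × ℝ × ℝ × ℝ) : ℝ × ℝ × ℝ × ℝ :=
  (p.2.1, -b p.2.2.1 - μ * D p.1 p.2.2.1 * p.2.1, p.2.2.2,
    -b p.2.2.1 - μ * D p.1 p.2.2.1 * p.2.1 - a * b p.2.2.1)

/-- The part `h > 0` of the phase space. -/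
def shellDomain : Set (ℝ × ℝ × ℝ × ℝ) := Ioi 0 ×ˢ univ

variable {a μ : ℝ} {b : ℝ → ℝ} {D : ℝ → ℝ → ℝ} {s : Set ℝ} {h v ξ w : ℝ → ℝ}

theorem IsShellMotion.mono {s' : Set ℝ} (H : IsShellMotion a μ b D s h v ξ w) (hs : s' ⊆ s) :
    IsShellMotion a μ b D s' h v ξ w :=
  ⟨fun t ht => H.pos t (hs ht), fun t ht => (H.deriv_h t (hs ht)).mono hs,
    fun t ht => (H.deriv_v t (hs ht)).mono hs, fun t ht => (H.deriv_ξ t (hs ht)).mono hs,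
    fun t ht => (H.deriv_w t (hs ht)).mono hs⟩

theorem HasDerivWithinAt.fst_real {E F : Type*} [NormedAddCommGroup E] [NormedSpace ℝ E]
    [NormedAddCommGroup F] [NormedSpace ℝ F] {f : ℝ → E × F} {f' : E × F} {s : Set ℝ} {t : ℝ}
    (hf : HasDerivWithinAt f f' s t) : HasDerivWithinAt (fun r => (f r).1) f'.1 s t :=
  (ContinuousLinearMap.fst ℝ E F).hasFDerivAt.comp_hasDerivWithinAt t hf

theorem HasDerivWithinAt.snd_real {E F : Type*} [NormedAddCommGroup E] [NormedSpace ℝ E]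
    [NormedAddCommGroup F] [NormedSpace ℝ F] {f : ℝ → E × F} {f' : E × F} {s : Set ℝ} {t : ℝ}
    (hf : HasDerivWithinAt f f' s t) : HasDerivWithinAt (fun r => (f r).2) f'.2 s t :=
  (ContinuousLinearMap.snd ℝ E F).hasFDerivAt.comp_hasDerivWithinAt t hf

theorem isShellMotion_of_isIntegralCurveOn {x : ℝ → ℝ × ℝ × ℝ × ℝ}
    (hx : IsIntegralCurveOn x (fun _ => shellField a μ b D) s) (hxU : MapsTo x s shellDomain) :
    IsShellMotion a μ b D s (fun t => (x t).1) (fun t => (x t).2.1) (fun t => (x t).2.2.1)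
      (fun t => (x t).2.2.2) :=
  ⟨fun _ ht => (hxU ht).1, fun t ht => (hx t ht).fst_real, fun t ht => (hx t ht).snd_real.fst_real,
    fun t ht => (hx t ht).snd_real.snd_real.fst_real,
    fun t ht => (hx t ht).snd_real.snd_real.snd_real⟩

theorem IsShellMotion.isIntegralCurveOn (H : IsShellMotion a μ b D s h v ξ w) :
    IsIntegralCurveOn (fun t => (h t, v t, ξ t, w t)) (fun _ => shellField a μ b D) s :=
  fun t ht => (H.deriv_h t ht).prodMk ((H.deriv_v t ht).prodMk
    ((H.deriv_ξ t ht).prodMk (H.deriv_w t ht)))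

theorem IsShellMotion.mapsTo (H : IsShellMotion a μ b D s h v ξ w) :
    MapsTo (fun t => (h t, v t, ξ t, w t)) s shellDomain :=
  fun t ht => mk_mem_prod (H.pos t ht) (mem_univ _)

theorem isGlobalSolution_iff {h₀ h₁ ξ₀ ξ₁ : ℝ} :
    IsGlobalSolution a μ b D h₀ h₁ ξ₀ ξ₁ h ξ ↔ ∃ v w : ℝ → ℝ,
      IsShellMotion a μ b D (Ici 0) h v ξ w ∧ h 0 = h₀ ∧ v 0 = h₁ ∧ ξ 0 = ξ₀ ∧ w 0 = ξ₁ := by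
  constructor
  · rintro ⟨hpos, v, A, w, A', hh, hξ, h0, v0, ξ0, w0, heq⟩
    refine ⟨v, w, ⟨hpos, fun t ht => (hh t ht).1, fun t ht => ?_, fun t ht => (hξ t ht).1,
      fun t ht => ?_⟩, h0, v0, ξ0, w0⟩
    · rw [← (heq t ht).2]; exact (hh t ht).2
    · have h1 := heq t ht
      rw [← h1.2, ← h1.1, sub_sub_cancel]
      exact (hξ t ht).2
  · rintro ⟨v, w, H, h0, v0, ξ0, w0⟩
    exact ⟨H.pos, v, _, w, _, fun t ht => ⟨H.deriv_h t ht, H.deriv_v t ht⟩,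
      fun t ht => ⟨H.deriv_ξ t ht, H.deriv_w t ht⟩, h0, v0, ξ0, w0,
      fun t _ => ⟨sub_sub_cancel _ _, rfl⟩⟩

theorem DragFactor.pos (hD : DragFactor D) {x : ℝ} (hx : 0 < x) (y : ℝ) : 0 < D x y := by
  obtain ⟨c, hc, α, -, h⟩ := hD.lower_bound
  exact (mul_pos hc (Real.rpow_pos_of_pos hx _)).trans_le (h x hx y)

theorem locallyLipschitzOn_shellField (hb : LocallyLipschitz b) (hD : DragFactor D) :
    LocallyLipschitzOn shellDomain (shellField a μ b D) := by
  have h1 : LocallyLipschitzOn shellDomain fun p : ℝ × ℝ × ℝ × ℝ => b p.2.2.1 :=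
    (hb.comp (g := fun p : ℝ × ℝ × ℝ × ℝ => p.2.2.1)
      (ContDiff.locallyLipschitz (𝕂 := ℝ) (by fun_prop))).locallyLipschitzOn
  have h2 : LocallyLipschitzOn shellDomain fun p : ℝ × ℝ × ℝ × ℝ => D p.1 p.2.2.1 :=
    hD.locallyLipschitzOn.comp_mapsTo (g := fun p : ℝ × ℝ × ℝ × ℝ => (p.1, p.2.2.1))
      (ContDiff.locallyLipschitz (𝕂 := ℝ) (by fun_prop)) (fun p hp => ⟨hp.1, mem_univ _⟩)
  have h3 : LocallyLipschitz fun q : (ℝ × ℝ × ℝ × ℝ) × ℝ × ℝ =>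
      (q.1.2.1, -q.2.1 - μ * q.2.2 * q.1.2.1, q.1.2.2.2,
        -q.2.1 - μ * q.2.2 * q.1.2.1 - a * q.2.1) :=
    ContDiff.locallyLipschitz (𝕂 := ℝ) (by fun_prop)
  exact h3.comp_locallyLipschitzOn
    ((LocallyLipschitz.id.locallyLipschitzOn (s := shellDomain)).prodMk (h1.prodMk h2))

theorem hasDerivAt_potential (hb : Continuous b) (y : ℝ) : HasDerivAt (potential b) (b y) y :=
  intervalIntegral.integral_hasDerivAt_right (hb.intervalIntegrable _ _)
    (hb.stronglyMeasurableAtFilter _ _) hb.continuousAt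

/-! ### Energy estimate and bounds uniform in the viscosity -/

/-- The energy `a v² / 2 + (v - w)² / 2 + a B(ξ)` is dissipated by the drag. -/
theorem IsShellMotion.energy_le (ha : 0 < a) (hμ : 0 < μ) (hb : Continuous b) (hD : DragFactor D)
    {τ : ℝ} (H : IsShellMotion a μ b D (Icc 0 τ) h v ξ w) {t : ℝ} (ht : t ∈ Icc 0 τ) :
    a * v t ^ 2 + (v t - w t) ^ 2 + 2 * a * potential b (ξ t) ≤
      a * v 0 ^ 2 + (v 0 - w 0) ^ 2 + 2 * a * potential b (ξ 0) := by
  have hd : ∀ t ∈ Icc 0 τ, HasDerivWithinAt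
      (fun t => a * v t ^ 2 + (v t - w t) ^ 2 + 2 * a * potential b (ξ t))
      (-(2 * a * μ * D (h t) (ξ t) * v t ^ 2)) (Icc 0 τ) t := by
    intro t ht
    have hv := H.deriv_v t ht
    have hw := H.deriv_w t ht
    have hB := (hasDerivAt_potential hb (ξ t)).comp_hasDerivWithinAt t (H.deriv_ξ t ht)
    refine ((((hv.pow 2).const_mul a).add ((hv.sub hw).pow 2)).add
      (hB.const_mul (2 * a))).congr_deriv ?_
    simp only [Pi.sub_apply]
    push_cast
    ring
  refine image_le_of_deriv_right_le_deriv_boundary (B := fun _ => a * v 0 ^ 2 + (v 0 - w 0) ^ 2 +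
    2 * a * potential b (ξ 0)) (B' := fun _ => 0) (fun t ht => (hd t ht).continuousWithinAt)
    (fun t ht => (hd t (Ico_subset_Icc_self ht)).Ici_of_Icc ht) le_rfl continuousOn_const
    (fun t _ => hasDerivWithinAt_const _ _ _) (fun t ht => ?_) ht
  have := hD.pos (H.pos t (Ico_subset_Icc_self ht)) (ξ t)
  have : 0 ≤ 2 * a * μ * D (h t) (ξ t) * v t ^ 2 := by positivity
  linarith

theorem ElasticResponse.exists_le_potential (hb : ElasticResponse b) :
    ∃ m, ∀ y, m ≤ potential b y := by
  have hc : Continuous (potential b) := continuous_iff_continuousAt.2 fun y =>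
    (hasDerivAt_potential hb.locallyLipschitz.continuous y).continuousAt
  obtain ⟨x, hx⟩ := hc.exists_forall_le hb.coercive
  exact ⟨_, hx⟩

theorem ElasticResponse.exists_abs_le (hb : ElasticResponse b) (C : ℝ) :
    ∃ R > 0, ∀ y, potential b y ≤ C → |y| ≤ R := by
  obtain ⟨K, hK, hKC⟩ := mem_cocompact.1 (hb.coercive.eventually (eventually_gt_atTop C))
  obtain ⟨R, hR, hKR⟩ := hK.isBounded.exists_pos_norm_le
  refine ⟨R, hR, fun y hy => hKR y ?_⟩
  by_contra hyK
  exact absurd hy (not_le.2 (hKC hyK))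

/-- The velocities and the elongation are bounded, uniformly in the viscosity and in time. -/
theorem ElasticResponse.exists_uniform_bounds (hb : ElasticResponse b) (ha : 0 < a) (h₁ : ℝ) :
    ∃ V > 0, ∃ R > 0, |h₁| ≤ V ∧ ∀ (D : ℝ → ℝ → ℝ) (μ τ : ℝ) (h v ξ w : ℝ → ℝ), DragFactor D →
      0 < μ → IsShellMotion a μ b D (Icc 0 τ) h v ξ w → v 0 = h₁ → ξ 0 = 0 → w 0 = 0 →
      ∀ t ∈ Icc 0 τ, |v t| ≤ V ∧ |w t| ≤ V ∧ |ξ t| ≤ R := by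
  obtain ⟨m, hm⟩ := hb.exists_le_potential
  have hm0 : m ≤ 0 := by simpa [potential] using hm 0
  set C := (a + 1) * h₁ ^ 2 - 2 * a * m with hC
  obtain ⟨R, hR, hBR⟩ := hb.exists_abs_le (C / (2 * a))
  have hC0 : 0 ≤ C := by
    have := mul_nonneg ha.le (neg_nonneg.2 hm0)
    have : 0 ≤ (a + 1) * h₁ ^ 2 := by positivity
    simp only [hC]; linarith
  have hCa : 0 ≤ C / a := by positivity
  set V := Real.sqrt (C / a) + Real.sqrt C + |h₁| + 1 with hV
  have s1 := Real.sqrt_nonneg (C / a)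
  have s2 := Real.sqrt_nonneg C
  have s3 := abs_nonneg h₁
  refine ⟨V, by linarith, R, hR, by linarith, ?_⟩
  intro D μ τ h v ξ w hD hμ H hv0 hξ0 hw0 t ht
  have hE := H.energy_le ha hμ hb.locallyLipschitz.continuous hD ht
  have hE0 : a * v 0 ^ 2 + (v 0 - w 0) ^ 2 + 2 * a * potential b (ξ 0) = (a + 1) * h₁ ^ 2 := by
    rw [hv0, hξ0, hw0]; simp [potential]; ring
  rw [hE0] at hE
  have hmt := mul_le_mul_of_nonneg_left (hm (ξ t)) (by positivity : 0 ≤ 2 * a)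
  have q1 : 0 ≤ a * v t ^ 2 := by positivity
  have q2 : 0 ≤ (v t - w t) ^ 2 := by positivity
  have e1 : |v t| ≤ Real.sqrt (C / a) := by
    apply Real.abs_le_sqrt
    rw [le_div_iff₀ ha]; linarith
  have e2 : |v t - w t| ≤ Real.sqrt C := by
    apply Real.abs_le_sqrt
    linarith
  refine ⟨by linarith, ?_, hBR _ ?_⟩
  · have : |w t| ≤ |v t| + |v t - w t| := by
      have := abs_sub (v t) (v t - w t)
      rwa [sub_sub_cancel] at this
    linarith
  · rw [le_div_iff₀ (by positivity)]
    have := mul_nonneg ha.le (neg_nonneg.2 hm0)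
    linarith

theorem abs_sub_le_mul_of_hasDerivWithinAt {f f' : ℝ → ℝ} {p q C : ℝ}
    (hf : ∀ t ∈ Icc p q, HasDerivWithinAt f (f' t) (Icc p q) t) (hC : ∀ t ∈ Icc p q, |f' t| ≤ C)
    {t r : ℝ} (ht : t ∈ Icc p q) (hr : r ∈ Icc p q) : |f r - f t| ≤ C * |r - t| :=
  (convex_Icc p q).norm_image_sub_le_of_norm_hasDerivWithin_le hf hC ht hr

/-! ### No contact in finite time -/

/-- On bounded ranges of `h` the drag dominates a multiple of `1 / h`, which is not integrable at
`h = 0`. -/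
theorem DragFactor.exists_div_le (hD : DragFactor D) {M : ℝ} (hM : 0 < M) :
    ∃ k > 0, ∀ x, 0 < x → x ≤ M → ∀ y, k / x ≤ D x y := by
  obtain ⟨c, hc, α, hα, hcD⟩ := hD.lower_bound
  refine ⟨c * M ^ (1 - α), by positivity, fun x hx hxM y => le_trans ?_ (hcD x hx y)⟩
  have h1 : x ^ (-α) = x ^ (1 - α) * x⁻¹ := by
    rw [← Real.rpow_neg_one x, ← Real.rpow_add hx]; congr 1; ring
  have h2 : M ^ (1 - α) ≤ x ^ (1 - α) := Real.rpow_le_rpow_of_nonpos hx hxM (by linarith)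
  rw [h1, div_eq_mul_inv, ← mul_assoc]
  have : 0 ≤ x⁻¹ := by positivity
  gcongr

/-- A lower bound for `h`. While `v < 0`, the drag term `-μ D v` is at least
`-μ k v / h = -μ k (log h)'`; while `v > 0`, `h` increases. So the right derivative of
`min v 0 + μ k log h` is bounded below by `-M`, where `M` bounds `|b(ξ)|`. -/
theorem IsShellMotion.le_log (hμ : 0 < μ) {k M τ : ℝ} (hk : 0 < k)
    (H : IsShellMotion a μ b D (Icc 0 τ) h v ξ w)
    (hkD : ∀ t ∈ Icc 0 τ, k / h t ≤ D (h t) (ξ t)) (hM : ∀ t ∈ Icc 0 τ, |b (ξ t)| ≤ M)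
    {t : ℝ} (ht : t ∈ Icc 0 τ) :
    min (v 0) 0 + μ * k * Real.log (h 0) - M * t ≤ μ * k * Real.log (h t) := by
  have h0mem : (0 : ℝ) ∈ Icc 0 τ := ⟨le_rfl, ht.1.trans ht.2⟩
  have hM0 : 0 ≤ M := (abs_nonneg _).trans (hM 0 h0mem)
  choose! d hd hneg hpos hzero using fun t (ht : t ∈ Ico 0 τ) =>
    ((H.deriv_v t (Ico_subset_Icc_self ht)).Ici_of_Icc ht).min_zero
  have hlogd : ∀ t ∈ Icc 0 τ,
      HasDerivWithinAt (fun t => Real.log (h t)) (v t / h t) (Icc 0 τ) t :=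
    fun t ht => (H.deriv_h t ht).log (H.pos t ht).ne'
  have hder : ∀ t ∈ Ico 0 τ, HasDerivWithinAt
      (fun t => -(min (v t) 0 + μ * k * Real.log (h t)))
      (-(d t + μ * k * (v t / h t))) (Ici t) t := fun t ht =>
    ((hd t ht).add (((hlogd t (Ico_subset_Icc_self ht)).Ici_of_Icc ht).const_mul _)).neg
  have hvc : ContinuousOn v (Icc 0 τ) := fun t ht => (H.deriv_v t ht).continuousWithinAt
  have hlc : ContinuousOn (fun t => Real.log (h t)) (Icc 0 τ) :=
    fun t ht => (hlogd t ht).continuousWithinAt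
  have hmain := image_le_of_deriv_right_le_deriv_boundary
    (f := fun t => -(min (v t) 0 + μ * k * Real.log (h t)))
    (B := fun t => -(min (v 0) 0 + μ * k * Real.log (h 0)) + M * t) (B' := fun _ => M)
    (by fun_prop) hder (by simp) (by fun_prop)
    (fun t _ => ((hasDerivAt_id t).const_mul M |>.const_add _).hasDerivWithinAt.congr_deriv
      (by simp))
    (fun t ht => ?_) ht
  · have := min_le_right (v t) 0
    linarith
  · have htI := Ico_subset_Icc_self ht
    have hht := H.pos t htI
    have hbM := abs_le.1 (hM t htI)
    rcases lt_trichotomy (v t) 0 with hv | hv | hv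
    · rw [hneg t ht hv]
      have h1 : μ * k * (v t / h t) = μ * (k / h t) * v t := by ring
      have h2 : μ * (k / h t) * -v t ≤ μ * D (h t) (ξ t) * -v t := by
        have := hkD t htI
        have : 0 ≤ -v t := by linarith
        gcongr
      linarith
    · rw [hzero t ht hv, hv]
      have : -M ≤ min (-b (ξ t) - μ * D (h t) (ξ t) * 0) 0 := le_min (by linarith) (by linarith)
      simp only [zero_div, mul_zero] at this ⊢
      linarith
    · rw [hpos t ht hv]
      have : 0 ≤ μ * k * (v t / h t) := by positivity
      linarith

theorem IsShellMotion.abs_h_sub_le {V τ : ℝ} (H : IsShellMotion a μ b D (Icc 0 τ) h v ξ w)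
    (hV : ∀ t ∈ Icc 0 τ, |v t| ≤ V) {t : ℝ} (ht : t ∈ Icc 0 τ) : |h t - h 0| ≤ V * t := by
  have := abs_sub_le_mul_of_hasDerivWithinAt H.deriv_h hV (left_mem_Icc.2 (ht.1.trans ht.2)) ht
  rwa [sub_zero, abs_of_nonneg ht.1] at this

theorem hasAPrioriBounds_shellField (hb : ElasticResponse b) (hD : DragFactor D) (ha : 0 < a)
    (hμ : 0 < μ) {h₀ h₁ : ℝ} (hh₀ : 0 < h₀) :
    HasAPrioriBounds (shellField a μ b D) shellDomain 0 (h₀, h₁, 0, 0) := by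
  intro T hT
  obtain ⟨V, hV, R, hR, hh₁V, hbd⟩ := hb.exists_uniform_bounds ha h₁
  obtain ⟨M, hM⟩ := (isCompact_Icc (a := -R) (b := R)).exists_bound_of_continuousOn
    hb.locallyLipschitz.continuous.continuousOn
  have hM0 : 0 ≤ M := (norm_nonneg _).trans (hM 0 ⟨by linarith, hR.le⟩)
  have hH : 0 < h₀ + V * T := by positivity
  obtain ⟨k, hk, hkD⟩ := hD.exists_div_le hH
  set δ := min h₀ (Real.exp ((min h₁ 0 + μ * k * Real.log h₀ - M * T) / (μ * k))) with hδ
  have hδ0 : 0 < δ := lt_min hh₀ (Real.exp_pos _)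
  have hδh : δ ≤ h₀ := min_le_left _ _
  have hVT : 0 < V * T := by positivity
  refine ⟨Icc (δ / 2) (h₀ + V * T + 1) ×ˢ Icc (-(V + 1)) (V + 1) ×ˢ Icc (-(R + 1)) (R + 1) ×ˢ
    Icc (-(V + 1)) (V + 1), ?_, ?_, ?_, ?_, ?_⟩
  · exact isCompact_Icc.prod (isCompact_Icc.prod (isCompact_Icc.prod isCompact_Icc))
  · exact (isLipschitzRetract_Icc (by linarith)).prod ((isLipschitzRetract_Icc (by linarith)).prod
      ((isLipschitzRetract_Icc (by linarith)).prod (isLipschitzRetract_Icc (by linarith))))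
  · exact fun p hp => ⟨(half_pos hδ0).trans_le hp.1.1, mem_univ _⟩
  · have := abs_le.1 hh₁V
    refine ⟨⟨?_, ?_⟩, ⟨?_, ?_⟩, ⟨?_, ?_⟩, ?_, ?_⟩ <;> simp only <;> linarith
  · intro τ hτ x hx0 hx hxU
    have H := isShellMotion_of_isIntegralCurveOn hx hxU
    have hτI : τ ∈ Icc 0 τ := ⟨hτ.1, le_rfl⟩
    have hall := hbd D μ τ _ _ _ _ hD hμ H (by simp [hx0]) (by simp [hx0]) (by simp [hx0])
    obtain ⟨bv, bw, bξ⟩ := hall τ hτI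
    have hle : ∀ t ∈ Icc 0 τ, |(x t).1 - h₀| ≤ V * T := by
      intro t ht
      have := H.abs_h_sub_le (fun t ht => (hall t ht).1) ht
      simp only [hx0] at this
      have h2 : V * t ≤ V * T := mul_le_mul_of_nonneg_left (ht.2.trans hτ.2) hV.le
      linarith
    have hlog := H.le_log hμ hk (M := M)
      (fun t ht => hkD _ (H.pos t ht) (by linarith [(abs_le.1 (hle t ht)).2]) _)
      (fun t ht => hM _ (abs_le.1 (hall t ht).2.2)) hτI
    have hτT : M * τ ≤ M * T := mul_le_mul_of_nonneg_left hτ.2 hM0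
    have hxτ : 0 < (x τ).1 := H.pos τ hτI
    have hδx : δ ≤ (x τ).1 := by
      refine (min_le_right _ _).trans ?_
      rw [← Real.le_log_iff_exp_le hxτ, div_le_iff₀ (by positivity)]
      simp only [hx0] at hlog
      linarith
    have := abs_le.1 (hle τ hτI)
    have := abs_le.1 bv
    have := abs_le.1 bw
    have := abs_le.1 bξ
    simp only [interior_prod_eq, interior_Icc]
    refine ⟨⟨?_, ?_⟩, ⟨?_, ?_⟩, ⟨?_, ?_⟩, ?_, ?_⟩ <;> linarith

theorem existsUnique_isGlobalSolution (hb : ElasticResponse b) (hD : DragFactor D) (ha : 0 < a)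
    (hμ : 0 < μ) {h₀ : ℝ} (h₁ : ℝ) (hh₀ : 0 < h₀) :
    ∃ h ξ : ℝ → ℝ, IsGlobalSolution a μ b D h₀ h₁ 0 0 h ξ ∧
      ∀ k η : ℝ → ℝ, IsGlobalSolution a μ b D h₀ h₁ 0 0 k η →
        EqOn k h (Ici 0) ∧ EqOn η ξ (Ici 0) := by
  obtain ⟨x, hx0, hx, hxU, huniq⟩ := (hasAPrioriBounds_shellField (h₁ := h₁) hb hD ha hμ
    hh₀).exists_global (locallyLipschitzOn_shellField hb.locallyLipschitz hD)
  refine ⟨fun t => (x t).1, fun t => (x t).2.2.1, isGlobalSolution_iff.2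
    ⟨_, _, isShellMotion_of_isIntegralCurveOn hx hxU, ?_⟩, fun k η hk => ?_⟩
  · simp [hx0]
  · obtain ⟨v, w, H, h0, v0, ξ0, w0⟩ := isGlobalSolution_iff.1 hk
    have := huniq _ (by simp [h0, v0, ξ0, w0]) H.isIntegralCurveOn H.mapsTo
    exact ⟨fun t ht => congrArg Prod.fst (this ht), fun t ht => congrArg (·.2.2.1) (this ht)⟩

/-! ### The free oscillator -/

theorem hasAPrioriBounds_oscillator (hb : ElasticResponse b) (ha : 0 < a) (t₀ v₀ : ℝ) :
    HasAPrioriBounds (fun p : ℝ × ℝ => (p.2, -(a * b p.1))) univ t₀ (0, v₀) := by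
  intro T hT
  obtain ⟨m, hm⟩ := hb.exists_le_potential
  have hm0 : m ≤ 0 := by simpa [potential] using hm 0
  obtain ⟨R, hR, hBR⟩ := hb.exists_abs_le (v₀ ^ 2 / (2 * a))
  set V := Real.sqrt (v₀ ^ 2 - 2 * a * m) with hV
  have hVv : |v₀| ≤ V := by
    apply Real.abs_le_sqrt
    have := mul_nonneg ha.le (neg_nonneg.2 hm0)
    linarith
  have hV0 : 0 ≤ V := Real.sqrt_nonneg _
  refine ⟨Icc (-(R + 1)) (R + 1) ×ˢ Icc (-(V + 1)) (V + 1), isCompact_Icc.prod isCompact_Icc,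
    (isLipschitzRetract_Icc (by linarith)).prod (isLipschitzRetract_Icc (by linarith)),
    subset_univ _, ?_, ?_⟩
  · have := abs_le.1 hVv
    refine ⟨⟨?_, ?_⟩, ?_, ?_⟩ <;> simp only <;> linarith
  · intro τ hτ x hx0 hx _
    have hτI : τ ∈ Icc t₀ τ := ⟨hτ.1, le_rfl⟩
    have hd : ∀ t ∈ Icc t₀ τ, HasDerivWithinAt
        (fun t => (x t).2 ^ 2 + 2 * a * potential b (x t).1) 0 (Icc t₀ τ) t := by
      intro t ht
      have hB := (hasDerivAt_potential hb.locallyLipschitz.continuous (x t).1).comp_hasDerivWithinAt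
        t (hx t ht).fst_real
      refine (((hx t ht).snd_real.pow 2).add (hB.const_mul (2 * a))).congr_deriv ?_
      push_cast
      ring
    have hE := constant_of_has_deriv_right_zero (fun t ht => (hd t ht).continuousWithinAt)
      (fun t ht => (hd t (Ico_subset_Icc_self ht)).Ici_of_Icc ht) τ hτI
    simp only [hx0] at hE
    rw [show potential b 0 = 0 by simp [potential], mul_zero, add_zero] at hE
    have hmτ := mul_le_mul_of_nonneg_left (hm (x τ).1) (by positivity : 0 ≤ 2 * a)
    have b1 : |(x τ).1| ≤ R := by
      apply hBR
      rw [le_div_iff₀ (by positivity)]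
      have := sq_nonneg (x τ).2
      linarith
    have b2 : |(x τ).2| ≤ V := by
      apply Real.abs_le_sqrt
      linarith
    have := abs_le.1 b1
    have := abs_le.1 b2
    simp only [interior_prod_eq, interior_Icc]
    refine ⟨⟨?_, ?_⟩, ?_, ?_⟩ <;> linarith

theorem existsUnique_isFreeOscillation (hb : ElasticResponse b) (ha : 0 < a) (t₀ v₀ : ℝ) :
    ∃ ζ : ℝ → ℝ, IsFreeOscillation a b t₀ v₀ ζ ∧
      ∀ η : ℝ → ℝ, IsFreeOscillation a b t₀ v₀ η → EqOn η ζ (Ici t₀) := by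
  have hlip : LocallyLipschitz fun p : ℝ × ℝ => (p.2, -(a * b p.1)) := by
    have h1 : LocallyLipschitz fun q : (ℝ × ℝ) × ℝ => (q.1.2, -(a * q.2)) :=
      ContDiff.locallyLipschitz (𝕂 := ℝ) (by fun_prop)
    exact h1.comp (LocallyLipschitz.id.prodMk
      (hb.locallyLipschitz.comp LipschitzWith.prod_fst.locallyLipschitz))
  obtain ⟨x, hx0, hx, -, huniq⟩ :=
    (hasAPrioriBounds_oscillator hb ha t₀ v₀).exists_global hlip.locallyLipschitzOn
  refine ⟨fun t => (x t).1, ⟨fun t => (x t).2, fun t => -(a * b (x t).1),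
    fun t ht => ⟨(hx t ht).fst_real, (hx t ht).snd_real⟩, by simp [hx0], by simp [hx0],
    fun t _ => by simp⟩, fun η hη => ?_⟩
  obtain ⟨v, A, hm, h0, v0, heq⟩ := hη
  have := huniq (fun t => (η t, v t)) (by simp [h0, v0]) (fun t ht => ?_) (mapsTo_univ _ _)
  · exact fun t ht => congrArg Prod.fst (this ht)
  · refine (hm t ht).1.prodMk ((hm t ht).2.congr_deriv ?_)
    linarith [heq t ht]

/-! ### The limit before contact -/

theorem tendsto_gronwallBound_zero {f : ℝ → ℝ} {l : Filter ℝ} (hf : Tendsto f l (𝓝 0)) (K x : ℝ) :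
    Tendsto (fun r => gronwallBound 0 K (f r) x) l (𝓝 0) := by
  have := ((gronwallBound_continuous_ε 0 K x).tendsto 0).comp hf
  rwa [gronwallBound_ε0_δ0] at this

theorem vanishingLimitOn_iff {f : ℝ → ℝ → ℝ} {F : ℝ → ℝ} {K : Set ℝ} :
    VanishingLimitOn f F K ↔ ∀ ε > 0, ∀ᶠ μ in 𝓝[>] (0 : ℝ), ∀ t ∈ K, |f μ t - F t| < ε := by
  simp only [VanishingLimitOn, Metric.tendstoUniformlyOn_iff, dist_comm (F _), Real.dist_eq]

/-- As long as the free flight `h₀ + h₁ t` stays away from the wall, the motion is a small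
perturbation of it: while `h ≥ δ`, the drag is `O(μ)`, and Grönwall's inequality keeps `h` close
to the free flight, hence above `δ`. -/
theorem eventually_close_to_free_flight (hb : ElasticResponse b) (hD : DragFactor D) (ha : 0 < a)
    (hb0 : b 0 = 0) {h₀ h₁ T δ : ℝ} (hT : 0 ≤ T) (hδ : 0 < δ)
    (hδT : ∀ t ∈ Icc 0 T, 2 * δ ≤ h₀ + h₁ * t) {h ξ : ℝ → ℝ → ℝ}
    (hsol : ∀ μ, 0 < μ → IsGlobalSolution a μ b D h₀ h₁ 0 0 (h μ) (ξ μ)) {ε : ℝ} (hε : 0 < ε) :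
    ∀ᶠ μ in 𝓝[>] (0 : ℝ), ∀ t ∈ Icc 0 T, |h μ t - (h₀ + h₁ * t)| < ε ∧ |ξ μ t| < ε := by
  obtain ⟨V, hV, R, hR, hh₁V, hbd⟩ := hb.exists_uniform_bounds ha h₁
  set X := h₀ + V * T with hX
  have hVT : 0 ≤ V * T := by positivity
  set K : Set (ℝ × ℝ × ℝ × ℝ) := Icc δ X ×ˢ Icc (-V) V ×ˢ Icc (-R) R ×ˢ Icc (-V) V with hK
  have hKc : IsCompact K := isCompact_Icc.prod (isCompact_Icc.prod (isCompact_Icc.prod isCompact_Icc))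
  have hKU : K ⊆ shellDomain := fun p hp => ⟨hδ.trans_le hp.1.1, mem_univ _⟩
  obtain ⟨L, hL⟩ := ((locallyLipschitzOn_shellField (a := a) (μ := 0) hb.locallyLipschitz
    hD).mono hKU).exists_lipschitzOnWith_of_compact hKc
  obtain ⟨M, hM⟩ := (isCompact_Icc.prod isCompact_Icc).exists_bound_of_continuousOn
    (hD.locallyLipschitzOn.continuousOn.mono (prod_mono
      (fun x (hx : x ∈ Icc δ X) => hδ.trans_le hx.1) (subset_univ (Icc (-R) R))))
  have h00 := hδT 0 ⟨le_rfl, hT⟩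
  rw [mul_zero, add_zero] at h00
  have hM0 : 0 ≤ M := (norm_nonneg _).trans
    (hM (δ, 0) ⟨⟨le_rfl, by linarith⟩, ⟨by linarith, hR.le⟩⟩)
  have hlim : Tendsto (fun μ => gronwallBound 0 L (μ * (M * V)) T) (𝓝[>] (0 : ℝ)) (𝓝 0) := by
    refine tendsto_gronwallBound_zero ?_ _ _
    have : Tendsto (fun μ : ℝ => μ * (M * V)) (𝓝 0) (𝓝 (0 * (M * V))) := tendsto_id.mul_const _
    rw [zero_mul] at this
    exact this.mono_left nhdsWithin_le_nhds
  filter_upwards [self_mem_nhdsWithin, hlim.eventually_lt_const (lt_min hδ hε)] with μ hμ hsmall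
  have hμ : 0 < μ := hμ
  obtain ⟨v, w, Hglob, h0, v0, ξ0, w0⟩ := isGlobalSolution_iff.1 (hsol μ hμ)
  have H : IsShellMotion a μ b D (Icc 0 T) (h μ) v (ξ μ) w := Hglob.mono Icc_subset_Ici_self
  have hall := hbd D μ T _ _ _ _ hD hμ H v0 ξ0 w0
  have hup : ∀ t ∈ Icc 0 T, h μ t ≤ X := by
    intro t ht
    have h1 := (abs_le.1 (H.abs_h_sub_le (fun t ht => (hall t ht).1) ht)).2
    have h2 : V * t ≤ V * T := mul_le_mul_of_nonneg_left ht.2 hV.le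
    rw [h0] at h1
    linarith
  -- Grönwall's inequality up to a time before which `h ≥ δ`
  have key : ∀ r ∈ Icc 0 T, (∀ t ∈ Ico 0 r, δ ≤ h μ t) →
      |h μ r - (h₀ + h₁ * r)| < min δ ε ∧ |ξ μ r| < min δ ε := by
    intro r hr hδr
    have hsub : Icc 0 r ⊆ Icc 0 T := Icc_subset_Icc_right hr.2
    have hI : IsIntegralCurveOn _ _ (Icc 0 r) := (H.mono hsub).isIntegralCurveOn
    have hg : ∀ t, HasDerivAt (fun t : ℝ => ((h₀ + h₁ * t, h₁, 0, 0) : ℝ × ℝ × ℝ × ℝ))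
        (h₁, 0, 0, 0) t := by
      intro t
      refine HasDerivAt.prodMk ?_ (hasDerivAt_const t (h₁, (0 : ℝ), (0 : ℝ)))
      simpa using ((hasDerivAt_id t).const_mul h₁).const_add h₀
    have hgron := dist_le_of_approx_trajectories_ODE_of_mem (v := fun _ => shellField a 0 b D)
      (s := fun _ => K) (εf := μ * (M * V)) (εg := 0) (δ := 0)
      (fun t _ => hL) hI.continuousOn_of_hasDerivWithinAt
      (fun t ht => hI.hasDerivWithinAt_Ici ht) (fun t ht => ?_) (fun t ht => ?_)
      (fun t _ => (hg t).continuousAt.continuousWithinAt) (fun t _ => (hg t).hasDerivWithinAt)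
      (fun t _ => ?_) (fun t ht => ?_) ?_ r ⟨hr.1, le_rfl⟩
    · have hmono : gronwallBound 0 L (μ * (M * V) + 0) (r - 0) ≤
          gronwallBound 0 L (μ * (M * V)) T := by
        rw [add_zero, sub_zero]
        exact gronwallBound_mono le_rfl (by positivity) L.2 hr.2
      have hlt := (hgron.trans hmono).trans_lt hsmall
      simp only [Prod.dist_eq, max_lt_iff, Real.dist_eq, sub_zero] at hlt
      exact ⟨hlt.1, hlt.2.2.1⟩
    · have htT : t ∈ Icc 0 T := hsub (Ico_subset_Icc_self ht)
      obtain ⟨bv, -, bξ⟩ := hall t htT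
      have hDM : |D (h μ t) (ξ μ t)| ≤ M :=
        hM (h μ t, ξ μ t) ⟨⟨hδr t ht, hup t htT⟩, abs_le.1 bξ⟩
      have hmain : |μ * D (h μ t) (ξ μ t) * v t| ≤ μ * (M * V) := by
        rw [abs_mul, abs_mul, abs_of_pos hμ, mul_assoc]
        gcongr
      rw [abs_le] at hmain
      have hnn : 0 ≤ μ * (M * V) := by positivity
      simp only [shellField, Prod.dist_eq, dist_self, Real.dist_eq, max_le_iff]
      refine ⟨hnn, ?_, hnn, ?_⟩
      · exact abs_le.2 ⟨by linarith [hmain.2], by linarith [hmain.1]⟩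
      · exact abs_le.2 ⟨by linarith [hmain.2], by linarith [hmain.1]⟩
    · have htT : t ∈ Icc 0 T := hsub (Ico_subset_Icc_self ht)
      obtain ⟨bv, bw, bξ⟩ := hall t htT
      exact ⟨⟨hδr t ht, hup t htT⟩, abs_le.1 bv, abs_le.1 bξ, abs_le.1 bw⟩
    · simp [shellField, hb0]
    · have htT : t ∈ Icc 0 T := hsub (Ico_subset_Icc_self ht)
      have h1 := hδT t htT
      have h2 : h₁ * t ≤ V * T :=
        mul_le_mul ((le_abs_self _).trans hh₁V) htT.2 htT.1 hV.le
      refine ⟨⟨?_, ?_⟩, abs_le.1 hh₁V, ⟨?_, ?_⟩, ?_, ?_⟩ <;> simp only <;> linarith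
    · simp [h0, v0, ξ0, w0]
  have hδh : ∀ t ∈ Icc 0 T, δ < h μ t := by
    by_contra! hne
    obtain ⟨t₁, ht₁, hxt₁⟩ := hne
    have hc : ContinuousOn (h μ) (Icc 0 T) := fun t ht => (H.deriv_h t ht).continuousWithinAt
    set A := Icc 0 T ∩ h μ ⁻¹' Iic δ with hA
    have hAb : BddBelow A := ⟨0, fun t ht => ht.1.1⟩
    have hsA : sInf A ∈ A := (hc.preimage_isClosed_of_isClosed isClosed_Icc isClosed_Iic).csInf_mem
      ⟨t₁, ht₁, hxt₁⟩ hAb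
    have h1 := (key _ hsA.1 fun t ht => ?_).1
    · have h2 := abs_lt.1 (h1.trans_le (min_le_left _ _))
      have h3 := hδT _ hsA.1
      have h4 : h μ (sInf A) ≤ δ := hsA.2
      linarith [h2.1]
    · by_contra! hlt
      exact absurd (csInf_le hAb ⟨⟨ht.1, ht.2.le.trans hsA.1.2⟩, hlt.le⟩) (not_le.2 ht.2)
  intro t ht
  obtain ⟨h1, h2⟩ := key t ht fun r hr => (hδh r ⟨hr.1, hr.2.le.trans ht.2⟩).le
  exact ⟨h1.trans_le (min_le_right _ _), h2.trans_le (min_le_right _ _)⟩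

theorem hitAndStick_eq {h₀ h₁ t : ℝ} (ht : 0 ≤ h₀ + h₁ * t) : hitAndStick h₀ h₁ t = h₀ + h₁ * t :=
  max_eq_right ht

/-- Up to the time of contact: away from that time the motion is close to the free flight, and the
remaining short time is covered by the uniform bounds on the velocities. -/
theorem vanishingLimitOn_until_contact (hb : ElasticResponse b) (hD : DragFactor D) (ha : 0 < a)
    (hb0 : b 0 = 0) {h₀ h₁ : ℝ} (hh₀ : 0 < h₀) (hh₁ : h₁ < 0) {h ξ : ℝ → ℝ → ℝ}
    (hsol : ∀ μ, 0 < μ → IsGlobalSolution a μ b D h₀ h₁ 0 0 (h μ) (ξ μ)) :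
    VanishingLimitOn h (hitAndStick h₀ h₁) (Icc 0 (-h₀ / h₁)) ∧
      VanishingLimitOn ξ (fun _ => 0) (Icc 0 (-h₀ / h₁)) := by
  obtain ⟨V, hV, R, hR, hh₁V, hbd⟩ := hb.exists_uniform_bounds ha h₁
  set t₀ := -h₀ / h₁ with ht₀
  have ht₀h : h₁ * t₀ = -h₀ := by rw [ht₀, mul_div_cancel₀ _ hh₁.ne]
  have ht₀pos : 0 < t₀ := div_pos_of_neg_of_neg (by linarith) hh₁
  have key : ∀ ε > 0, ∀ᶠ μ in 𝓝[>] (0 : ℝ), ∀ t ∈ Icc 0 t₀,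
      |h μ t - (h₀ + h₁ * t)| < ε ∧ |ξ μ t| < ε := by
    intro ε hε
    set η := min (t₀ / 2) (ε / (4 * V)) with hη
    have hη0 : 0 < η := by positivity
    have hηt : η ≤ t₀ / 2 := min_le_left _ _
    have hηV : V * η ≤ ε / 4 := by
      have : V * η ≤ V * (ε / (4 * V)) := mul_le_mul_of_nonneg_left (min_le_right _ _) hV.le
      rwa [show V * (ε / (4 * V)) = ε / 4 by field_simp] at this
    have hδ : 0 < -h₁ * η / 2 := by
      have := mul_pos (neg_pos.2 hh₁) hη0
      linarith
    have hT : 0 ≤ t₀ - η := by linarith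
    have hclose := eventually_close_to_free_flight hb hD ha hb0 hT hδ (fun t ht => ?_) hsol
      (half_pos hε)
    · filter_upwards [hclose, self_mem_nhdsWithin] with μ hc hμ t ht
      rcases le_total t (t₀ - η) with htT | htT
      · have := hc t ⟨ht.1, htT⟩
        exact ⟨by linarith [this.1], by linarith [this.2]⟩
      · obtain ⟨v, w, Hglob, h0, v0, ξ0, w0⟩ := isGlobalSolution_iff.1 (hsol μ hμ)
        have H : IsShellMotion a μ b D (Icc 0 t₀) (h μ) v (ξ μ) w := Hglob.mono Icc_subset_Ici_self
        have hall := hbd D μ t₀ _ _ _ _ hD hμ H v0 ξ0 w0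
        have hTm : t₀ - η ∈ Icc 0 t₀ := ⟨hT, by linarith⟩
        have d1 := abs_sub_le_mul_of_hasDerivWithinAt H.deriv_h (fun t ht => (hall t ht).1) hTm ht
        have d2 := abs_sub_le_mul_of_hasDerivWithinAt H.deriv_ξ (fun t ht => (hall t ht).2.1) hTm ht
        have htη : |t - (t₀ - η)| ≤ η := by
          rw [abs_of_nonneg (by linarith)]; linarith [ht.2]
        have d3 : V * |t - (t₀ - η)| ≤ ε / 4 :=
          (mul_le_mul_of_nonneg_left htη hV.le).trans hηV
        have d4 : |h₁ * (t - (t₀ - η))| ≤ ε / 4 := by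
          rw [abs_mul]
          exact (mul_le_mul_of_nonneg_right hh₁V (abs_nonneg _)).trans d3
        obtain ⟨c1, c2⟩ := hc _ ⟨hT, le_rfl⟩
        rw [abs_lt] at c1 c2 ⊢
        rw [abs_le] at d1 d2 d4
        rw [abs_lt]
        refine ⟨⟨?_, ?_⟩, ?_, ?_⟩ <;> linarith
    · have : h₁ * (t₀ - η - t) ≤ 0 := mul_nonpos_of_nonpos_of_nonneg hh₁.le (by linarith [ht.2])
      linarith
  constructor <;> rw [vanishingLimitOn_iff] <;> intro ε hε <;>
    filter_upwards [key ε hε] with μ hμ t ht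
  · rw [hitAndStick_eq]
    · exact (hμ t ht).1
    · have : h₁ * (t₀ - t) ≤ 0 := mul_nonpos_of_nonpos_of_nonneg hh₁.le (by linarith [ht.2])
      linarith
  · simpa using (hμ t ht).2

theorem vanishingLimitOnCompacts_of_Icc {f : ℝ → ℝ → ℝ} {F : ℝ → ℝ}
    (hf : ∀ T > 0, VanishingLimitOn f F (Icc 0 T)) : VanishingLimitOnCompacts f F := by
  intro K hK hK0
  obtain ⟨T, hT, hKT⟩ := hK.isBounded.exists_pos_norm_le
  exact (hf T hT).mono fun t ht => ⟨hK0 ht, (le_abs_self t).trans (hKT t ht)⟩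

theorem vanishingLimitOnCompacts_of_nonneg (hb : ElasticResponse b) (hD : DragFactor D)
    (ha : 0 < a) (hb0 : b 0 = 0) {h₀ h₁ : ℝ} (hh₀ : 0 < h₀) (hh₁ : 0 ≤ h₁) {h ξ : ℝ → ℝ → ℝ}
    (hsol : ∀ μ, 0 < μ → IsGlobalSolution a μ b D h₀ h₁ 0 0 (h μ) (ξ μ)) :
    VanishingLimitOnCompacts h (hitAndStick h₀ h₁) ∧
      VanishingLimitOnCompacts ξ (fun _ => 0) := by
  have key : ∀ T > 0, ∀ ε > 0, ∀ᶠ μ in 𝓝[>] (0 : ℝ), ∀ t ∈ Icc 0 T,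
      |h μ t - (h₀ + h₁ * t)| < ε ∧ |ξ μ t| < ε := fun T hT ε hε =>
    eventually_close_to_free_flight hb hD ha hb0 hT.le (half_pos hh₀)
      (fun t ht => by linarith [mul_nonneg hh₁ ht.1]) hsol hε
  constructor <;> refine vanishingLimitOnCompacts_of_Icc fun T hT => ?_ <;>
    rw [vanishingLimitOn_iff] <;> intro ε hε <;> filter_upwards [key T hT ε hε] with μ hμ t ht
  · rw [hitAndStick_eq (by linarith [mul_nonneg hh₁ ht.1])]
    exact (hμ t ht).1
  · simpa using (hμ t ht).2

/-! ### The limit after contact -/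

theorem eq_zero_of_potential_nonneg (hb : Continuous b) (hB : ∀ y, 0 ≤ potential b y) :
    b 0 = 0 := by
  refine IsLocalMin.hasDerivAt_eq_zero (f := potential b) (a := 0) ?_ (hasDerivAt_potential hb 0)
  exact Eventually.of_forall fun y => by simpa [potential] using hB y

/-- If the drag does not depend on `ξ`, it is a total time derivative `(G(h))'`, so that
`a v + (v - w) + a μ G(h)` is conserved. Together with `a v² + (v - w)² ≤ (a + 1) h₁²`, which the
energy estimate gives for `B ≥ 0`, this bounds the distance of `(v, v - w)` from `(h₁, h₁)`, the
only point where equality holds in the Cauchy-Schwarz inequality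
`(a v + (v - w))² ≤ (a + 1) (a v² + (v - w)²)`. -/
theorem IsShellMotion.sq_velocity_sub_le (ha : 0 < a) (hμ : 0 < μ) (hb : Continuous b)
    (hB : ∀ y, 0 ≤ potential b y) (hD : DragFactor D) {G : ℝ → ℝ} {h₀ h₁ : ℝ}
    (hG : ∀ x, 0 < x → ∀ y, HasDerivAt G (D x y) x) (hG0 : G h₀ = 0) {τ : ℝ}
    (H : IsShellMotion a μ b D (Icc 0 τ) h v ξ w) (h0 : h 0 = h₀) (v0 : v 0 = h₁) (ξ0 : ξ 0 = 0)
    (w0 : w 0 = 0) {t : ℝ} (ht : t ∈ Icc 0 τ) :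
    (v t - h₁) ^ 2 ≤ 2 * μ * h₁ * G (h t) := by
  have hE := H.energy_le ha hμ hb hD ht
  rw [v0, ξ0, w0, show potential b 0 = 0 by simp [potential]] at hE
  have hBt := mul_nonneg (by positivity : 0 ≤ 2 * a) (hB (ξ t))
  have hd : ∀ t ∈ Icc 0 τ, HasDerivWithinAt
      (fun t => a * v t + (v t - w t) + a * μ * G (h t)) 0 (Icc 0 τ) t := by
    intro t ht
    have hGt := (hG (h t) (H.pos t ht) (ξ t)).comp_hasDerivWithinAt t (H.deriv_h t ht)
    refine ((((H.deriv_v t ht).const_mul a).add ((H.deriv_v t ht).sub (H.deriv_w t ht))).add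
      (hGt.const_mul (a * μ))).congr_deriv ?_
    ring
  have hcons := constant_of_has_deriv_right_zero (fun t ht => (hd t ht).continuousWithinAt)
      (fun t ht => (hd t (Ico_subset_Icc_self ht)).Ici_of_Icc ht) t ht
  simp only [h0, v0, w0, hG0] at hcons
  have hsq := sq_nonneg (v t - w t - h₁)
  have hlin : h₁ * (a * v t + (v t - w t)) = h₁ * ((a + 1) * h₁ - a * μ * G (h t)) := by
    congr 1; linarith
  -- expand `a (v - h₁)² + (v - w - h₁)²` and insert the two relations
  refine le_of_mul_le_mul_left ?_ ha
  nlinarith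

/-- A function with `f > 0` whose derivative is close to `h₁ < 0` as long as `f ≥ ε` is close to
the hit-and-stick profile: it follows the free flight down to the level `ε`, above which it cannot
return. -/
theorem abs_sub_hitAndStick_le {f f' : ℝ → ℝ} {h₀ h₁ T ε η : ℝ}
    (hf : ∀ t ∈ Icc 0 T, HasDerivWithinAt f (f' t) (Icc 0 T) t) (hpos : ∀ t ∈ Icc 0 T, 0 < f t)
    (hf0 : f 0 = h₀) (hh₁ : h₁ < 0) (hη : 0 ≤ η) (hη₁ : η < -h₁) (hε : 0 ≤ ε)
    (hf' : ∀ t ∈ Icc 0 T, ε ≤ f t → |f' t - h₁| ≤ η) {t : ℝ} (ht : t ∈ Icc 0 T) :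
    |f t - hitAndStick h₀ h₁ t| ≤ ε + η * T := by
  have hηt : η * t ≤ η * T := mul_le_mul_of_nonneg_left ht.2 hη
  have hfc : ContinuousOn f (Icc 0 T) := fun t ht => (hf t ht).continuousWithinAt
  have hfly : ∀ r ∈ Icc 0 T, (∀ t ∈ Ico 0 r, ε ≤ f t) → |f r - (h₀ + h₁ * r)| ≤ η * r := by
    intro r hr hε'
    have hsub : Icc 0 r ⊆ Icc 0 T := Icc_subset_Icc_right hr.2
    have hd : ∀ t ∈ Icc 0 T, HasDerivWithinAt (fun t => f t - h₁ * t) (f' t - h₁) (Icc 0 T) t :=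
      fun t ht => ((hf t ht).sub ((hasDerivAt_id t).const_mul h₁).hasDerivWithinAt).congr_deriv
        (by simp)
    have := norm_image_sub_le_of_norm_deriv_right_le_segment
      (fun t ht => ((hd t (hsub ht)).continuousWithinAt).mono hsub)
      (fun t ht => ((hd t (hsub (Ico_subset_Icc_self ht))).mono hsub).Ici_of_Icc ht)
      (fun t ht => hf' t (hsub (Ico_subset_Icc_self ht)) (hε' t ht)) r ⟨hr.1, le_rfl⟩
    rw [Real.norm_eq_abs, mul_zero, sub_zero, sub_zero, hf0] at this
    rwa [show f r - h₁ * r - h₀ = f r - (h₀ + h₁ * r) by ring] at this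
  by_cases hex : ∃ r ∈ Icc 0 t, f r ≤ ε
  · obtain ⟨r₁, hr₁, hfr₁⟩ := hex
    have hsubt : Icc 0 t ⊆ Icc 0 T := Icc_subset_Icc_right ht.2
    set A := Icc 0 t ∩ f ⁻¹' Iic ε with hA
    have hAb : BddBelow A := ⟨0, fun t ht => ht.1.1⟩
    have hsA : sInf A ∈ A := ((hfc.mono hsubt).preimage_isClosed_of_isClosed isClosed_Icc
      isClosed_Iic).csInf_mem ⟨r₁, hr₁, hfr₁⟩ hAb
    set r := sInf A with hr
    have hfr : f r ≤ ε := hsA.2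
    have h1 := (abs_le.1 (hfly r (hsubt hsA.1) fun x hx => ?_)).1
    · have hsub : Icc r t ⊆ Icc 0 T := Icc_subset_Icc hsA.1.1 ht.2
      -- the derivative is negative at the level `ε`
      have h2 : f t ≤ ε := image_le_of_deriv_right_lt_deriv_boundary (B := fun _ => ε)
        (B' := fun _ => 0) (hfc.mono hsub)
        (fun x hx => ((hf x (hsub (Ico_subset_Icc_self hx))).mono hsub).Ici_of_Icc hx) hfr
        (fun x => hasDerivAt_const _ _) (fun x hx hxε => by
          have := (abs_le.1 (hf' x (hsub (Ico_subset_Icc_self hx)) hxε.ge)).2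
          linarith) ⟨hsA.1.2, le_rfl⟩
      have h3 := hpos t ht
      have h4 : η * r ≤ η * T := mul_le_mul_of_nonneg_left (hsubt hsA.1).2 hη
      have h5 : h₁ * (t - r) ≤ 0 := mul_nonpos_of_nonpos_of_nonneg hh₁.le (by linarith [hsA.1.2])
      have hηT : 0 ≤ η * T := mul_nonneg hη (ht.1.trans ht.2)
      have h6 : hitAndStick h₀ h₁ t ≤ ε + η * T := max_le (by linarith) (by linarith)
      have h7 : 0 ≤ hitAndStick h₀ h₁ t := le_max_left _ _
      rw [abs_le]
      constructor <;> linarith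
    · by_contra! hlt
      exact absurd (csInf_le hAb ⟨⟨hx.1, hx.2.le.trans hsA.1.2⟩, hlt.le⟩) (not_le.2 hx.2)
  · push Not at hex
    have h1 := hfly t ht fun r hr => (hex r (Ico_subset_Icc_self hr)).le
    have h2 : |f t - hitAndStick h₀ h₁ t| ≤ |f t - (h₀ + h₁ * t)| := by
      have := abs_max_sub_max_le_abs (f t) (h₀ + h₁ * t) 0
      rwa [max_eq_left (hpos t ht).le, max_comm] at this
    linarith

/-- Under the rigid-shell condition the drag has a primitive `G` in `h`; it is increasing. -/
theorem RigidDrag.exists_primitive (hR : RigidDrag D) (hD : DragFactor D) {h₀ : ℝ}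
    (hh₀ : 0 < h₀) : ∃ G : ℝ → ℝ, G h₀ = 0 ∧ (∀ x, 0 < x → ∀ y, HasDerivAt G (D x y) x) ∧
      MonotoneOn G (Ioi 0) := by
  obtain ⟨C₁, hC₁, C₂, hC₂, α, hα, g, hg, hgC, hgD⟩ := hR
  have hind : ∀ x, 0 < x → ∀ y, D x y = D x 0 := fun x hx y => by rw [hgD x hx, hgD x hx]
  have hc : ContinuousOn (fun x => D x 0) (Ioi 0) :=
    hD.locallyLipschitzOn.continuousOn.comp (f := fun x : ℝ => (x, (0 : ℝ))) (by fun_prop)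
      fun x hx => ⟨hx, mem_univ _⟩
  have hG : ∀ x, 0 < x → HasDerivAt (fun x => ∫ s in h₀..x, D s 0) (D x 0) x := by
    intro x hx
    refine intervalIntegral.integral_hasDerivAt_right ?_ ?_ (hc.continuousAt (Ioi_mem_nhds hx))
    · refine (hc.mono fun y hy => ?_).intervalIntegrable
      exact (lt_min hh₀ hx).trans_le hy.1
    · exact hc.stronglyMeasurableAtFilter isOpen_Ioi x hx
  refine ⟨fun x => ∫ s in h₀..x, D s 0, intervalIntegral.integral_same,
    fun x hx y => by rw [hind x hx y]; exact hG x hx, ?_⟩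
  refine monotoneOn_of_deriv_nonneg (convex_Ioi 0)
    (fun x hx => (hG x hx).continuousAt.continuousWithinAt) ?_ ?_
  · rw [interior_Ioi]
    exact fun x hx => (hG x hx).differentiableAt.differentiableWithinAt
  · rw [interior_Ioi]
    intro x hx
    rw [(hG x hx).deriv]
    exact (hD.pos hx 0).le

theorem vanishingLimitOn_hitAndStick (hb : ElasticResponse b) (hB : ∀ y, 0 ≤ potential b y)
    (hD : DragFactor D) (hR : RigidDrag D) (ha : 0 < a) {h₀ h₁ : ℝ} (hh₀ : 0 < h₀) (hh₁ : h₁ < 0)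
    {h ξ : ℝ → ℝ → ℝ}
    (hsol : ∀ μ, 0 < μ → IsGlobalSolution a μ b D h₀ h₁ 0 0 (h μ) (ξ μ)) {T : ℝ} (hT : 0 < T) :
    VanishingLimitOn h (hitAndStick h₀ h₁) (Icc 0 T) := by
  rw [vanishingLimitOn_iff]
  intro ε hε
  obtain ⟨G, hG0, hG, hGm⟩ := hR.exists_primitive hD hh₀
  have hε3 : 0 < ε / 3 := by positivity
  set η := min (-h₁ / 2) (ε / (3 * T)) with hη
  have hη0 : 0 < η := lt_min (by linarith) (by positivity)
  have hη1 : η < -h₁ := (min_le_left _ _).trans_lt (by linarith)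
  have hηT : η * T ≤ ε / 3 := by
    have : η * T ≤ ε / (3 * T) * T := mul_le_mul_of_nonneg_right (min_le_right _ _) hT.le
    rwa [show ε / (3 * T) * T = ε / 3 by field_simp] at this
  have hlim : Tendsto (fun μ => 2 * μ * h₁ * G (ε / 3)) (𝓝[>] (0 : ℝ)) (𝓝 0) := by
    have hc : Continuous fun μ : ℝ => 2 * μ * h₁ * G (ε / 3) := by fun_prop
    have := hc.tendsto 0
    simp only [mul_zero, zero_mul] at this
    exact this.mono_left nhdsWithin_le_nhds
  filter_upwards [self_mem_nhdsWithin, hlim.eventually_lt_const (pow_pos hη0 2)]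
    with μ hμ hsmall t ht
  have hμ : 0 < μ := hμ
  obtain ⟨v, w, Hglob, h0, v0, ξ0, w0⟩ := isGlobalSolution_iff.1 (hsol μ hμ)
  have H : IsShellMotion a μ b D (Icc 0 T) (h μ) v (ξ μ) w := Hglob.mono Icc_subset_Ici_self
  have := abs_sub_hitAndStick_le H.deriv_h H.pos h0 hh₁ hη0.le hη1 hε3.le (fun t ht hεt => ?_) ht
  · linarith
  · have h1 := H.sq_velocity_sub_le ha hμ hb.locallyLipschitz.continuous hB hD hG hG0 h0 v0 ξ0 w0 ht
    have h2 : G (ε / 3) ≤ G (h μ t) := hGm hε3 (H.pos t ht) hεt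
    have h3 : 2 * μ * h₁ * G (h μ t) ≤ 2 * μ * h₁ * G (ε / 3) :=
      mul_le_mul_of_nonpos_left h2 (by nlinarith)
    exact abs_le_of_sq_le_sq ((h1.trans h3).trans hsmall.le) hη0.le

/-- Convergence of `h` to the hit-and-stick profile `H` implies that of `ξ`. The difference
`z = h - ξ` solves `z'' = a b(h - z)`, and `Z = H - y`, with `y` the limit, is the solution of
`Z'' = a b(H - Z)` with the same initial data; note that `Z` is of class `C²` also at the time of
contact, in contrast to `H` and `y`. -/
theorem vanishingLimitOn_oscillation (hb : ElasticResponse b) (hb0 : b 0 = 0)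
    (hD : DragFactor D) (ha : 0 < a) {h₀ h₁ : ℝ} (hh₀ : 0 < h₀) (hh₁ : h₁ < 0)
    {h ξ : ℝ → ℝ → ℝ}
    (hsol : ∀ μ, 0 < μ → IsGlobalSolution a μ b D h₀ h₁ 0 0 (h μ) (ξ μ)) {ζ : ℝ → ℝ}
    (hζ : IsFreeOscillation a b (-h₀ / h₁) (-h₁) ζ) {T : ℝ}
    (hlimH : VanishingLimitOn h (hitAndStick h₀ h₁) (Icc 0 T)) :
    VanishingLimitOn ξ (fun t => if t ≤ -h₀ / h₁ then 0 else ζ t) (Icc 0 T) := by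
  rw [vanishingLimitOn_iff] at hlimH ⊢
  intro ε hε
  obtain ⟨V, hV, R, hR, hh₁V, hbd⟩ := hb.exists_uniform_bounds ha h₁
  set t₀ := -h₀ / h₁ with ht₀
  have ht₀h : h₁ * t₀ = -h₀ := by rw [ht₀, mul_div_cancel₀ _ hh₁.ne]
  have ht₀pos : 0 < t₀ := div_pos_of_neg_of_neg (by linarith) hh₁
  obtain ⟨u, A, hmot, ζ0, u0, heq⟩ := hζ
  -- `ζ (max t t₀)` vanishes for `t ≤ t₀` and so is the limit of `ξ`
  set y : ℝ → ℝ := fun t => ζ (max t t₀) with hy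
  have hy_eq : ∀ t, (if t ≤ t₀ then 0 else ζ t) = y t := by
    intro t
    split_ifs with htt
    · simp only [hy, max_eq_right htt, ζ0]
    · simp only [hy, max_eq_left (not_le.1 htt).le]
  simp only [hy_eq]
  have hmaps : ∀ t : ℝ, max t t₀ ∈ Ici t₀ := fun t => mem_Ici.2 (le_max_right t t₀)
  have hyc : Continuous y := by
    refine ContinuousOn.comp_continuous (s := Ici t₀) (fun t ht => ?_) (by fun_prop) hmaps
    exact (hmot t ht).1.continuousWithinAt
  set q : ℝ → ℝ := fun t => -u (max t t₀) with hq
  have hqc : Continuous q := by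
    refine (ContinuousOn.comp_continuous (s := Ici t₀) (fun t ht => ?_) (by fun_prop) hmaps).neg
    exact (hmot t ht).2.continuousWithinAt
  have hHc : Continuous (hitAndStick h₀ h₁) := by unfold hitAndStick; fun_prop
  have hbefore : ∀ t ≤ t₀, hitAndStick h₀ h₁ t = h₀ + h₁ * t := fun t ht => hitAndStick_eq (by
    have : h₁ * (t₀ - t) ≤ 0 := mul_nonpos_of_nonpos_of_nonneg hh₁.le (by linarith)
    linarith)
  have hafter : ∀ t, t₀ ≤ t → hitAndStick h₀ h₁ t = 0 := fun t ht => max_eq_left (by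
    have : h₁ * (t - t₀) ≤ 0 := mul_nonpos_of_nonpos_of_nonneg hh₁.le (by linarith)
    linarith)
  have hZ : ∀ t, HasDerivWithinAt (fun t => (hitAndStick h₀ h₁ t - y t, q t))
      (q t, a * b (y t)) (Ici t) t := by
    intro t
    rcases lt_or_ge t t₀ with htt | htt
    · have hq' : q t = h₁ := by simp only [hq, max_eq_right htt.le, u0, neg_neg]
      have hy' : y t = 0 := by simp only [hy, max_eq_right htt.le, ζ0]
      rw [hq', hy', hb0, mul_zero]
      have h1 : HasDerivAt (fun t : ℝ => (h₀ + h₁ * t, h₁)) (h₁, 0) t := by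
        refine HasDerivAt.prodMk ?_ (hasDerivAt_const t h₁)
        simpa using ((hasDerivAt_id t).const_mul h₁).const_add h₀
      refine (h1.congr_of_eventuallyEq ?_).hasDerivWithinAt
      filter_upwards [Iio_mem_nhds htt] with r hr
      have hr : r < t₀ := hr
      simp only [hq, hy, max_eq_right hr.le, u0, ζ0, neg_neg, sub_zero, hbefore r hr.le]
    · have hsub : Ici t ⊆ Ici t₀ := Ici_subset_Ici.2 htt
      have hA : -A t = a * b (ζ t) := by linarith [heq t htt]
      simp only [hq, hy, max_eq_left htt, ← hA]
      have h1 := ((hmot t htt).1.mono hsub).neg.prodMk ((hmot t htt).2.mono hsub).neg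
      refine h1.congr (fun r hr => ?_) ?_
      · have hr : t₀ ≤ r := hsub hr
        simp [hafter r hr, max_eq_left hr]
      · simp [hafter t htt, max_eq_left htt]
  have hZc : ContinuousOn (fun t => (hitAndStick h₀ h₁ t - y t, q t)) (Icc 0 T) :=
    ((hHc.sub hyc).prodMk hqc).continuousOn
  obtain ⟨Y, hY⟩ := (isCompact_Icc (a := 0) (b := T)).exists_bound_of_continuousOn hyc.continuousOn
  set R' := max (R + 1) Y with hR'
  obtain ⟨L, hL⟩ := (hb.locallyLipschitz.locallyLipschitzOn
    (s := Icc (-R') R')).exists_lipschitzOnWith_of_compact isCompact_Icc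
  set Λ : NNReal := max 1 (Real.toNNReal a * L) with hΛ
  have hΛ1 : (1 : ℝ) ≤ Λ := by exact_mod_cast le_max_left _ _
  have hΛa : a * L ≤ Λ := by
    have : Real.toNNReal a * L ≤ Λ := le_max_right _ _
    have := NNReal.coe_le_coe.2 this
    rwa [NNReal.coe_mul, Real.coe_toNNReal a ha.le] at this
  have hlim : Tendsto (fun e => e + gronwallBound 0 Λ (a * (L * e)) T) (𝓝[>] (0 : ℝ)) (𝓝 0) := by
    have hc : Tendsto (fun e : ℝ => a * (L * e)) (𝓝[>] (0 : ℝ)) (𝓝 0) := by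
      have hc : Continuous fun e : ℝ => a * (L * e) := by fun_prop
      have := hc.tendsto 0
      simp only [mul_zero] at this
      exact this.mono_left nhdsWithin_le_nhds
    have hid : Tendsto (fun e : ℝ => e) (𝓝[>] (0 : ℝ)) (𝓝 0) := nhdsWithin_le_nhds
    simpa using hid.add (tendsto_gronwallBound_zero hc Λ T)
  obtain ⟨e, he, he0, he1⟩ := ((hlim.eventually_lt_const hε).and
    (Ioc_mem_nhdsGT (zero_lt_one' ℝ))).exists
  filter_upwards [self_mem_nhdsWithin, hlimH e he0] with μ hμ hμe t ht
  have hμ : 0 < μ := hμ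
  obtain ⟨v, w, Hglob, h0, v0, ξ0, w0⟩ := isGlobalSolution_iff.1 (hsol μ hμ)
  have H : IsShellMotion a μ b D (Icc 0 T) (h μ) v (ξ μ) w := Hglob.mono Icc_subset_Ici_self
  have hall := hbd D μ T _ _ _ _ hD hμ H v0 ξ0 w0
  have hz : ∀ t ∈ Icc 0 T, HasDerivWithinAt (fun t => (h μ t - ξ μ t, v t - w t))
      (v t - w t, a * b (ξ μ t)) (Icc 0 T) t := fun t ht =>
    ((H.deriv_h t ht).sub (H.deriv_ξ t ht)).prodMk
      (((H.deriv_v t ht).sub (H.deriv_w t ht)).congr_deriv (by ring))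
  have hξR : ∀ t ∈ Icc 0 T, ξ μ t ∈ Icc (-R') R' := fun t ht =>
    abs_le.1 ((hall t ht).2.2.trans (by linarith [le_max_left (R + 1) Y]))
  have hzR : ∀ t ∈ Icc 0 T, hitAndStick h₀ h₁ t - (h μ t - ξ μ t) ∈ Icc (-R') R' := fun t ht => by
    have h1 := abs_lt.1 (hμe t ht)
    have h2 := abs_le.1 (hall t ht).2.2
    have h3 := le_max_left (R + 1) Y
    constructor <;> linarith [h1.1, h1.2, h2.1, h2.2]
  have hgron := dist_le_of_approx_trajectories_ODE_of_mem
    (v := fun t (p : ℝ × ℝ) => (p.2, a * b (hitAndStick h₀ h₁ t - p.1)))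
    (s := fun t => {p : ℝ × ℝ | hitAndStick h₀ h₁ t - p.1 ∈ Icc (-R') R'}) (K := Λ)
    (εf := a * (L * e)) (εg := 0) (δ := 0)
    (fun t _ => ?_) (fun t ht => (hz t ht).continuousWithinAt)
    (fun t ht => (hz t (Ico_subset_Icc_self ht)).Ici_of_Icc ht) (fun t ht => ?_)
    (fun t ht => hzR t (Ico_subset_Icc_self ht))
    hZc (fun t _ => hZ t) (fun t _ => ?_) (fun t ht => ?_)
    ?_ t ht
  · have hmono : gronwallBound 0 Λ (a * (L * e) + 0) (t - 0) ≤
        gronwallBound 0 Λ (a * (L * e)) T := by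
      rw [add_zero, sub_zero]
      exact gronwallBound_mono le_rfl (by positivity) Λ.2 ht.2
    have h1 := hgron.trans hmono
    simp only [Prod.dist_eq, max_le_iff, Real.dist_eq] at h1
    have h2 := abs_le.1 h1.1
    have h3 := abs_lt.1 (hμe t ht)
    rw [abs_lt]
    constructor <;> linarith [h2.1, h2.2, h3.1, h3.2]
  · refine LipschitzOnWith.of_dist_le_mul fun p hp p' hp' => ?_
    have h1 := hL.dist_le_mul _ hp _ hp'
    rw [Real.dist_eq, Real.dist_eq, sub_sub_sub_cancel_left] at h1
    have hd1 : |p.1 - p'.1| ≤ dist p p' := le_max_left _ _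
    have hd2 : |p.2 - p'.2| ≤ dist p p' := le_max_right _ _
    have hd0 : 0 ≤ dist p p' := dist_nonneg
    rw [Prod.dist_eq]
    simp only [Real.dist_eq, ← mul_sub, abs_mul, abs_of_pos ha]
    refine max_le (hd2.trans ?_) ?_
    · calc dist p p' = 1 * dist p p' := (one_mul _).symm
        _ ≤ Λ * dist p p' := by gcongr
    · rw [abs_sub_comm p'.1] at h1
      calc a * _ ≤ a * (L * dist p p') := by gcongr; exact h1.trans (by gcongr)
        _ = a * L * dist p p' := by ring
        _ ≤ Λ * dist p p' := by gcongr
  · have htT := Ico_subset_Icc_self ht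
    have h1 := hL.dist_le_mul _ (hξR t htT) _ (hzR t htT)
    have h2 : |ξ μ t - (hitAndStick h₀ h₁ t - (h μ t - ξ μ t))| ≤ e := by
      rw [show ξ μ t - (hitAndStick h₀ h₁ t - (h μ t - ξ μ t)) = h μ t - hitAndStick h₀ h₁ t by ring]
      exact (hμe t htT).le
    rw [Real.dist_eq, Real.dist_eq] at h1
    rw [Prod.dist_eq]
    simp only [dist_self, Real.dist_eq, ← mul_sub, abs_mul, abs_of_pos ha]
    refine max_le (by positivity) ?_
    gcongr
    exact h1.trans (by gcongr)
  · simp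
  · have := abs_le.1 (hY t (Ico_subset_Icc_self ht))
    have h3 : Y ≤ R' := le_max_right _ _
    change hitAndStick h₀ h₁ t - (hitAndStick h₀ h₁ t - y t) ∈ Icc (-R') R'
    rw [sub_sub_cancel]
    constructor <;> linarith [this.1, this.2]
  · simp [h0, v0, ξ0, w0, hbefore 0 ht₀pos.le, hy, hq, max_eq_right ht₀pos.le, ζ0, u0]

theorem theorem3p2 (a : ℝ) (ha : 0 < a) (b : ℝ → ℝ) (hb : ElasticResponse b)
    (D : ℝ → ℝ → ℝ) (hD : DragFactor D) (h₀ h₁ : ℝ) (hh₀ : 0 < h₀) :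
    -- for every viscosity there is exactly one global solution
    (∀ μ, 0 < μ → ∃ h ξ : ℝ → ℝ, IsGlobalSolution a μ b D h₀ h₁ 0 0 h ξ ∧
      ∀ k η : ℝ → ℝ, IsGlobalSolution a μ b D h₀ h₁ 0 0 k η →
        EqOn k h (Ici 0) ∧ EqOn η ξ (Ici 0)) ∧
    -- and the family of these solutions has the following limits
    ∀ h ξ : ℝ → ℝ → ℝ, (∀ μ, 0 < μ → IsGlobalSolution a μ b D h₀ h₁ 0 0 (h μ) (ξ μ)) →
      -- (i)
      (b 0 = 0 → h₁ < 0 →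
        VanishingLimitOn h (hitAndStick h₀ h₁) (Icc 0 (-h₀ / h₁)) ∧
        VanishingLimitOn ξ (fun _ => 0) (Icc 0 (-h₀ / h₁))) ∧
      -- (ii)
      (b 0 = 0 → 0 ≤ h₁ →
        VanishingLimitOnCompacts h (hitAndStick h₀ h₁) ∧
        VanishingLimitOnCompacts ξ (fun _ => 0)) ∧
      -- (iii)
      (h₁ < 0 → (∀ y, 0 ≤ potential b y) → RigidDrag D →
        ∃ ζ : ℝ → ℝ, IsFreeOscillation a b (-h₀ / h₁) (-h₁) ζ ∧
          (∀ η : ℝ → ℝ, IsFreeOscillation a b (-h₀ / h₁) (-h₁) η →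
            EqOn η ζ (Ici (-h₀ / h₁))) ∧
          VanishingLimitOnCompacts h (hitAndStick h₀ h₁) ∧
          VanishingLimitOnCompacts ξ (fun t => if t ≤ -h₀ / h₁ then 0 else ζ t)) := by
  refine ⟨fun μ hμ => existsUnique_isGlobalSolution hb hD ha hμ h₁ hh₀, fun h ξ hsol =>
    ⟨fun hb0 hh₁ => vanishingLimitOn_until_contact hb hD ha hb0 hh₀ hh₁ hsol,
      fun hb0 hh₁ => vanishingLimitOnCompacts_of_nonneg hb hD ha hb0 hh₀ hh₁ hsol,
      fun hh₁ hB hR => ?_⟩⟩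
  obtain ⟨ζ, hζ, huniq⟩ := existsUnique_isFreeOscillation hb ha (-h₀ / h₁) (-h₁)
  have hb0 := eq_zero_of_potential_nonneg hb.locallyLipschitz.continuous hB
  have hlimH : ∀ T > 0, VanishingLimitOn h (hitAndStick h₀ h₁) (Icc 0 T) := fun T hT =>
    vanishingLimitOn_hitAndStick hb hB hD hR ha hh₀ hh₁ hsol hT
  exact ⟨ζ, hζ, huniq, vanishingLimitOnCompacts_of_Icc hlimH,
    vanishingLimitOnCompacts_of_Icc fun T hT =>
      vanishingLimitOn_oscillation hb hb0 hD ha hh₀ hh₁ hsol hζ (hlimH T hT)⟩
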